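/- Let $\mathcal C\subset\mathbb R^2$ be a finite set. A point $P\in\mathcal C$ is extremal if $\mathrm{conv}(\mathcal C\setminus\{P\})\neq\mathrm{conv}(\mathcal C)$, and $\mathcal C$ is weakly convex if it is contained in the boundary of its convex hull $\mathrm{conv}(\mathcal C)$. The edges of a weakly convex $\mathcal C$ are the segments joining two consecutive extremal points; an edge has weight $a$ if it contains exactly $a+1$ points of $\mathcal C$. A triangulation of $\mathcal C$ is a finite set of Euclidean triangles with vertices in $\mathcal C$ whose union is $\mathrm{conv}(\mathcal C)$ and such that any two distinct triangles that meet intersect in a common vertex or a common edge. It is maximal if every point of $\mathcal C$ is a vertex of at least one of its triangles. For $m\ge 1$ let $$p_m(t)=\sum_{k=0}^{\lfloor m/2\rfloor}(-1)^k\binom{m-k}{k}t^{m-k},$$ let $C_k=\frac1{k+1}\binom{2k}{k}$ be the Catalan numbers, $G_C(t)=\sum_{k\ge0}C_kt^k$, and for a polynomial $p(t)=\sum_{k\ge 2}\alpha_kt^k$ put $\langle p(t),t^2G_C(t)\rangle_t=\sum_{k\ge2}\alpha_kC_{k-2}$. **Theorem.** Let $l\ge 3$ and $a_1,\dots,a_l\ge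 1$ be natural numbers, and let $\mathcal C$ be any weakly convex configuration with exactly $l$ edges, of weights $a_1,\dots,a_l$ in counterclockwise order. Then the number $\tau_{\max}(a_1,\dots,a_l)$ of maximal triangulations of $\mathcal C$ is $$\tau_{\max}(a_1,\dots,a_l)=\Big\langle\prod_{i=1}^l p_{a_i}(t),\,t^2G_C(t)\Big\rangle_t=\sum_{k\ge2}b_k\,C_{k-2},\qquad\text{where }\prod_{i=1}^l p_{a_i}(t)=\sum_k b_kt^k .$$ -/

import Mathlib

open scoped Polynomial PowerSeries

noncomputable section

namespace WeaklyConvex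

/-- The Euclidean plane. -/
abbrev Plane : Type := EuclideanSpace ℝ (Fin 2)

/-! ### Triangulations of planar configurations -/

/-- A triangulation of the finite configuration `C`. A Euclidean triangle is given by the set of
its three (non-collinear) vertices. Two triangles `s`, `t` meet in the convex hull of their common
vertices, so that, for `s ≠ t`, the intersection is empty, a common vertex or a common edge. -/
structure IsTriangulation (C : Finset Plane) (T : Finset (Finset Plane)) : Prop where
  subset : ∀ t ∈ T, t ⊆ C
  card_eq : ∀ t ∈ T, t.card = 3
  indep : ∀ t ∈ T, AffineIndependent ℝ ((↑) : t → Plane)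
  cover : (⋃ t ∈ T, convexHull ℝ (t : Set Plane)) = convexHull ℝ (C : Set Plane)
  inter : ∀ s ∈ T, ∀ t ∈ T, s ≠ t →
    convexHull ℝ (s : Set Plane) ∩ convexHull ℝ (t : Set Plane) =
      convexHull ℝ ((s : Set Plane) ∩ (t : Set Plane))

/-- A triangulation of `C` is maximal if every point of `C` is a vertex of at least one of its
triangles. -/
def IsMaximalTriangulation (C : Finset Plane) (T : Finset (Finset Plane)) : Prop :=
  IsTriangulation C T ∧ ∀ P ∈ C, ∃ t ∈ T, P ∈ t

theorem finite_setOf_isMaximalTriangulation (C : Finset Plane) :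
    {T : Finset (Finset Plane) | IsMaximalTriangulation C T}.Finite :=
  (C.powerset.powerset.finite_toSet).subset fun _ hT =>
    Finset.mem_coe.2 (Finset.mem_powerset.2 fun t ht => Finset.mem_powerset.2 (hT.1.subset t ht))

/-- The number of maximal triangulations of `C`. -/
def tauMax (C : Finset Plane) : ℕ :=
  Set.ncard {T : Finset (Finset Plane) | IsMaximalTriangulation C T}

/-! ### Weakly convex polygons -/

/-- `C` is weakly convex if it is contained in the boundary of its convex hull. -/
def IsWeaklyConvex (C : Finset Plane) : Prop :=
  (C : Set Plane) ⊆ frontier (convexHull ℝ (C : Set Plane))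

/-- The extremal points of `C`: those whose removal changes the convex hull. -/
def extr (C : Finset Plane) : Set Plane :=
  {P | P ∈ C ∧ convexHull ℝ ((C : Set Plane) \ {P}) ≠ convexHull ℝ (C : Set Plane)}

/-- Twice the signed area of the triangle `P Q R`; it is nonnegative iff `R` lies on the line
`P Q` or on its left when going from `P` to `Q` (for `P ≠ Q`). -/
def orient (P Q R : Plane) : ℝ :=
  (Q 0 - P 0) * (R 1 - P 1) - (Q 1 - P 1) * (R 0 - P 0)

/-- `C` is a weakly convex polygon `P(a₁, …, a_l)` whose `l` edges, in counterclockwise order, have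
weights `a₁, …, a_l`. The points `v i` are the extremal points of `C` in counterclockwise order:
all of `C` lies weakly to the left of each directed line from `v i` to its cyclic successor. The
edges are the segments joining consecutive extremal points, and an edge has weight `a` if it
contains exactly `a + 1` points of `C`. -/
def IsPolygonOfWeights {l : ℕ} (a : Fin l → ℕ) (C : Finset Plane) : Prop :=
  IsWeaklyConvex C ∧ ∃ v : Fin l → Plane,
    Function.Injective v ∧ Set.range v = extr C ∧
    ∀ i : Fin l,
      (∀ P ∈ C, 0 ≤ orient (v i) (v (finRotate l i)) P) ∧
      Set.ncard {P : Plane | P ∈ C ∧ P ∈ segment ℝ (v i) (v (finRotate l i))} = a i + 1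

/-! ### Edge polynomials and the umbral pairing -/

/-- The maximal edge polynomial `p_m(t) = ∑_{k=0}^{⌊m/2⌋} (-1)^k (m-k choose k) t^(m-k)`. -/
def edgePoly (m : ℕ) : ℤ[X] :=
  ∑ k ∈ Finset.range (m / 2 + 1),
    Polynomial.C ((-1 : ℤ) ^ k * ((m - k).choose k : ℤ)) * Polynomial.X ^ (m - k)

/-- The generating function `G_C(t) = ∑_{k ≥ 0} C_k t^k` of the Catalan numbers, over `ℤ`. -/
def genCatalan : ℤ⟦X⟧ := PowerSeries.map (Nat.castRingHom ℤ) PowerSeries.catalanSeries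

/-- The duality pairing `⟨∑ αₖ tᵏ, ∑ γₖ tᵏ⟩_t = ∑ αₖ γₖ` between polynomials and formal power
series. -/
def pairing (p : ℤ[X]) (f : ℤ⟦X⟧) : ℤ :=
  p.sum fun k c => c * PowerSeries.coeff k f

end WeaklyConvex

end

/-!
Let `n` be the number of points of the configuration and list them counterclockwise, from a corner,
as `c 0, …, c (n - 1)`. Every triple is then counterclockwise or collinear (`IsConvexSeq`), and it
is collinear only if it lies on a common side (`exists_enumeration`).

*Triangulations are recursive.* Suppose that the triangles of a maximal triangulation with vertices
in the arc `i, …, j` cover the polygon spanned by the arc. One of them then has the chord `c i`,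
`c j` as a side, namely one that contains the midpoint of the chord
(`IsIndexTri.exists_chord_triangle`; maximality is what forbids a longer side through the midpoint).
If its third vertex is `c k`, then no other triangle has vertices on both sides of `k`, since its
side would cross the triangle (`IsIndexTri.subset_or_subset`). So the triangulation splits into
triangulations of the arcs `i, …, k` and `k, …, j`. Conversely, gluing always gives a maximal
triangulation. Hence the maximal triangulations are those defined by the recursion `IsArcTri`
(`isIndexTri_iff_isArcTri`), starting from the root chord `c 0`, `c (n - 1)`.

*Counting.* For the arc from `i` to `j` let `P[i,j]` (`arcPoly`) be the product of the edge
polynomials of the pieces into which the corners cut it. As `p_{m+2} = t (p_{m+1} - p_m)`, these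
products satisfy a three-term recurrence in `j`, and by induction
`(x - y) ∑ P[i,k](x) P[k,j](y) = x P[i,j](x) - y P[i,j](y)`, the sum being over all `k` of the arc
(`sum_arcPoly_eq_convolution`). Applying in both variables the functional `t ^ k ↦ C_{k-1}`, for
which the right-hand side is the Catalan recurrence, shows that the numbers obtained from `P[i,j]`
satisfy the recursion of `IsArcTri` (`sum_arcCount`, `hasCount_arcCount`); on arcs of length at
least two inside one side, where all triangles are degenerate, these numbers vanish. In the root
triangle the third vertex must avoid the last side, on which both `c 0` and `c (n - 1)` lie. If that
side has weight at least two, this removes some terms from the sum for the arc `0, …, n - 1`, of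
which only the one with `k = n - 2` is nonzero, and the three-term recurrence identifies the
difference with `t ^ k ↦ C_{k-2}` applied to the product of all edge polynomials
(`sum_arcCount_root`).
-/

noncomputable section

namespace WeaklyConvex

open Finset.HasAntidiagonal (antidiagonal mem_antidiagonal)

/-! ### Orientation and convex hulls in the plane -/

theorem orient_rotate (P Q R : Plane) : orient Q R P = orient P Q R := by
  simp only [orient]; ring

theorem orient_swap (P Q R : Plane) : orient Q P R = -orient P Q R := by
  simp only [orient]; ring

theorem orient_swap_right (P Q R : Plane) : orient P R Q = -orient P Q R := by
  simp only [orient]; ring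

@[simp] theorem orient_self_left (P Q : Plane) : orient P Q P = 0 := by
  simp only [orient]; ring

@[simp] theorem orient_self_right (P Q : Plane) : orient P Q Q = 0 := by
  simp only [orient]; ring

@[simp] theorem orient_self (P Q : Plane) : orient P P Q = 0 := by
  simp only [orient]; ring

theorem orient_add_orient_add_orient (P Q R X : Plane) :
    orient P Q X + orient Q R X + orient R P X = orient P Q R := by
  simp only [orient]; ring

theorem orient_combo (A B x y : Plane) {a b : ℝ} (h : a + b = 1) :
    orient A B (a • x + b • y) = a * orient A B x + b * orient A B y := by
  obtain rfl : a = 1 - b := by linarith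
  simp only [orient, PiLp.add_apply, PiLp.smul_apply, smul_eq_mul]; ring

theorem orient_lineMap (A B x y : Plane) (s : ℝ) :
    orient A B (AffineMap.lineMap x y s) = (1 - s) * orient A B x + s * orient A B y := by
  rw [AffineMap.lineMap_apply_module, orient_combo _ _ _ _ (by ring)]

theorem orient_lineMap_lineMap (A B Z : Plane) (s u : ℝ) :
    orient (AffineMap.lineMap A B s) (AffineMap.lineMap A B u) Z = (u - s) * orient A B Z := by
  simp only [orient, AffineMap.lineMap_apply_module, PiLp.add_apply, PiLp.smul_apply, smul_eq_mul]
  ring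

/-- The Grassmann-Plücker relation for four vectors issuing from `O`. -/
theorem orient_plucker (O E X Y Z : Plane) :
    orient O E Y * orient O X Z = orient O E X * orient O Y Z + orient O E Z * orient O X Y := by
  simp only [orient]; ring

theorem convex_orient_nonneg (A B : Plane) : Convex ℝ {p | 0 ≤ orient A B p} := by
  intro x hx y hy a b ha hb h
  simp only [Set.mem_ofPred_eq] at *
  rw [orient_combo _ _ _ _ h]
  positivity

theorem orient_nonneg_of_mem_convexHull {A B p : Plane} {S : Set Plane}
    (hS : ∀ x ∈ S, 0 ≤ orient A B x) (hp : p ∈ convexHull ℝ S) : 0 ≤ orient A B p :=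
  convexHull_min hS (convex_orient_nonneg A B) hp

theorem orient_nonpos_of_mem_convexHull {A B p : Plane} {S : Set Plane}
    (hS : ∀ x ∈ S, orient A B x ≤ 0) (hp : p ∈ convexHull ℝ S) : orient A B p ≤ 0 := by
  have := orient_nonneg_of_mem_convexHull (A := B) (B := A) (S := S) (p := p)
    (fun x hx => by rw [orient_swap]; linarith [hS x hx]) hp
  rw [orient_swap] at this; linarith

/-- A supporting line of `S` meets the convex hull of `S` in the convex hull of the points of `S`
on it. -/
theorem mem_convexHull_inter_line {A B p : Plane} {S : Set Plane}
    (hS : ∀ x ∈ S, 0 ≤ orient A B x) (hp : p ∈ convexHull ℝ S) (h0 : orient A B p = 0) :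
    p ∈ convexHull ℝ (S ∩ {x | orient A B x = 0}) := by
  have key : convexHull ℝ S ⊆ {q | 0 < orient A B q ∨
      (orient A B q = 0 ∧ q ∈ convexHull ℝ (S ∩ {x | orient A B x = 0}))} := by
    refine convexHull_min (fun x hx => ?_) ?_
    · rcases (hS x hx).lt_or_eq with h | h
      · exact Or.inl h
      · exact Or.inr ⟨h.symm, subset_convexHull ℝ _ ⟨hx, h.symm⟩⟩
    · intro x hx y hy a b ha hb h
      simp only [Set.mem_ofPred_eq] at *
      rw [orient_combo _ _ _ _ h]
      rcases ha.eq_or_lt with rfl | ha'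
      · obtain rfl : b = 1 := by linarith
        simpa using hy
      rcases hb.eq_or_lt with rfl | hb'
      · obtain rfl : a = 1 := by linarith
        simpa using hx
      rcases hx with hx | ⟨hx, hx'⟩
      · left
        have : 0 ≤ orient A B y := by rcases hy with hy | hy; exacts [hy.le, hy.1.ge]
        have := mul_pos ha' hx
        have : 0 ≤ b * orient A B y := by positivity
        linarith
      rcases hy with hy | ⟨hy, hy'⟩
      · left; rw [hx]; have := mul_pos hb' hy; linarith
      · right; exact ⟨by rw [hx, hy]; ring, convex_convexHull ℝ _ hx' hy' ha hb h⟩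
  rcases key hp with h | h
  · exact absurd h0 h.ne'
  · exact h.2

theorem mem_convexHull_inter_line' {A B p : Plane} {S : Set Plane}
    (hS : ∀ x ∈ S, orient A B x ≤ 0) (hp : p ∈ convexHull ℝ S) (h0 : orient A B p = 0) :
    p ∈ convexHull ℝ (S ∩ {x | orient A B x = 0}) := by
  have := mem_convexHull_inter_line (A := B) (B := A) (S := S) (p := p)
    (fun x hx => by rw [orient_swap]; linarith [hS x hx]) hp (by rw [orient_swap, h0, neg_zero])
  simpa only [orient_swap A B, neg_eq_zero] using this

theorem plane_ext {P Q : Plane} (h0 : P 0 = Q 0) (h1 : P 1 = Q 1) : P = Q := by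
  ext i; fin_cases i
  · exact h0
  · exact h1

theorem sq_dist_pos {A B : Plane} (h : A ≠ B) : 0 < (B 0 - A 0) ^ 2 + (B 1 - A 1) ^ 2 := by
  by_contra hc
  have h0 : (B 0 - A 0) ^ 2 = 0 := by nlinarith [sq_nonneg (B 0 - A 0), sq_nonneg (B 1 - A 1)]
  have h1 : (B 1 - A 1) ^ 2 = 0 := by nlinarith [sq_nonneg (B 0 - A 0), sq_nonneg (B 1 - A 1)]
  rw [sq_eq_zero_iff, sub_eq_zero] at h0 h1
  exact h (plane_ext h0.symm h1.symm)

theorem exists_lineMap_of_orient_eq_zero {A B P : Plane} (hAB : A ≠ B) (h : orient A B P = 0) :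
    ∃ s : ℝ, P = AffineMap.lineMap A B s := by
  have hd := sq_dist_pos hAB
  refine ⟨((B 0 - A 0) * (P 0 - A 0) + (B 1 - A 1) * (P 1 - A 1)) /
    ((B 0 - A 0) ^ 2 + (B 1 - A 1) ^ 2), ?_⟩
  simp only [orient] at h
  apply plane_ext <;>
    simp only [AffineMap.lineMap_apply_module, PiLp.add_apply, PiLp.smul_apply, smul_eq_mul] <;>
    field_simp
  · linear_combination -(B 1 - A 1) * h
  · linear_combination (B 0 - A 0) * h

theorem orient_eq_zero_of_three {A B P Q R : Plane} (hAB : A ≠ B) (hP : orient A B P = 0)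
    (hQ : orient A B Q = 0) (hR : orient A B R = 0) : orient P Q R = 0 := by
  obtain ⟨s, rfl⟩ := exists_lineMap_of_orient_eq_zero hAB hP
  obtain ⟨u, rfl⟩ := exists_lineMap_of_orient_eq_zero hAB hQ
  rw [orient_lineMap_lineMap, hR, mul_zero]

/-- A point on the inner side of all three edges of a triangle lies in it: the three orientations
are its barycentric coordinates up to scale. -/
theorem mem_convexHull_triangle {A B D p : Plane} (hD : 0 < orient A B D)
    (h1 : 0 ≤ orient A B p) (h2 : 0 ≤ orient B D p) (h3 : 0 ≤ orient D A p) :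
    p ∈ convexHull ℝ ({A, B, D} : Set Plane) := by
  have hs := orient_add_orient_add_orient A B D p
  have hp : p = (orient B D p / orient A B D) • A + (orient D A p / orient A B D) • B +
      (orient A B p / orient A B D) • D := by
    apply plane_ext <;> simp only [PiLp.add_apply, PiLp.smul_apply, smul_eq_mul] <;>
      field_simp <;> simp only [orient] <;> ring
  rw [hp]
  refine (convex_convexHull ℝ ({A, B, D} : Set Plane)).sum_mem (t := Finset.univ (α := Fin 3))
    (w := ![orient B D p / orient A B D, orient D A p / orient A B D, orient A B p / orient A B D])
    (z := ![A, B, D]) ?_ ?_ ?_ |> fun h => by simpa [Fin.sum_univ_three] using h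
  · intro i _; fin_cases i <;> simp <;> positivity
  · simp only [Fin.sum_univ_three, Matrix.cons_val]
    rw [← add_div, ← add_div, div_eq_one_iff_eq hD.ne']; linarith
  · intro i _; apply subset_convexHull; fin_cases i <;> simp

theorem eq_of_orient_eq_zero_of_orient_eq_zero {A B D p : Plane} (hD : orient A B D ≠ 0)
    (h1 : orient A B p = 0) (h2 : orient B D p = 0) : p = B := by
  have hAB : A ≠ B := by rintro rfl; simp at hD
  obtain ⟨s, rfl⟩ := exists_lineMap_of_orient_eq_zero hAB h1
  rw [orient_lineMap, orient_self_left, orient_rotate, mul_zero, add_zero] at h2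
  have hs : s = 1 := by
    rcases mul_eq_zero.1 h2 with h | h
    · linarith
    · exact absurd h hD
  simp [hs]

theorem affineIndependent_triple {A B D : Plane} (h : orient A B D ≠ 0) :
    AffineIndependent ℝ ![A, B, D] := by
  rw [affineIndependent_iff_not_collinear_set]
  intro hcol
  obtain ⟨p₀, w, hw⟩ := (collinear_iff_exists_forall_eq_smul_vadd (k := ℝ) _).1 hcol
  obtain ⟨a, rfl⟩ := hw A (by simp)
  obtain ⟨b, rfl⟩ := hw B (by simp)
  obtain ⟨d, rfl⟩ := hw D (by simp)
  apply h
  simp only [orient, vadd_eq_add, PiLp.add_apply, PiLp.smul_apply, smul_eq_mul]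
  ring

theorem not_affineIndependent_triple {A B D : Plane} (h : orient A B D = 0) :
    ¬ AffineIndependent ℝ ![A, B, D] := by
  intro hi
  have hAB : A ≠ B := fun e => by
    have := hi.injective (a₁ := 0) (a₂ := 1) (by simpa using e)
    simp at this
  obtain ⟨s, rfl⟩ := exists_lineMap_of_orient_eq_zero hAB h
  rw [affineIndependent_iff_not_collinear_set] at hi
  apply hi
  rw [collinear_iff_of_mem (p₀ := A) (by simp)]
  refine ⟨B - A, ?_⟩
  intro p hp
  simp only [Set.mem_insert_iff, Set.mem_singleton_iff] at hp
  rcases hp with rfl | rfl | rfl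
  · exact ⟨0, by simp⟩
  · exact ⟨1, by simp⟩
  · exact ⟨s, by simp [AffineMap.lineMap_apply]⟩

/-! ### Weakly convex sequences of points -/

/-- The points `c 0, …, c (n - 1)` are distinct, and any three of them, taken in this order, are
counterclockwise or collinear. -/
structure IsConvexSeq (c : ℕ → Plane) (n : ℕ) : Prop where
  inj : ∀ x y, x < n → y < n → c x = c y → x = y
  nonneg : ∀ x y z, x < y → y < z → z < n → 0 ≤ orient (c x) (c y) (c z)

namespace IsConvexSeq

variable {c : ℕ → Plane} {n : ℕ}

theorem orient_nonneg (h : IsConvexSeq c n) {x y z : ℕ} (hxy : x ≤ y) (hyz : y ≤ z) (hz : z < n) :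
    0 ≤ orient (c x) (c y) (c z) := by
  rcases hxy.eq_or_lt with rfl | hxy
  · simp
  rcases hyz.eq_or_lt with rfl | hyz
  · simp
  exact h.nonneg x y z hxy hyz hz

theorem orient_nonpos_of_mem_Icc (h : IsConvexSeq c n) {i k m : ℕ} (hm : i ≤ m ∧ m ≤ k)
    (hk : k < n) : orient (c i) (c k) (c m) ≤ 0 := by
  have := h.orient_nonneg hm.1 hm.2 hk
  rw [orient_swap_right] at this; linarith

theorem orient_nonneg_of_le (h : IsConvexSeq c n) {i k m : ℕ} (hik : i ≤ k) (hm : m ≤ i)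
    (hk : k < n) : 0 ≤ orient (c i) (c k) (c m) := by
  rw [orient_rotate]; exact h.orient_nonneg hm hik hk

/-- If a point strictly between `c i` and `c k` on their segment belongs to the arc from `i` to `k`,
then the whole arc is flat. -/
theorem orient_eq_zero_of_between (h : IsConvexSeq c n) {i k m : ℕ} (him : i < m) (hmk : m < k)
    (hk : k < n) {s : ℝ} (hs0 : 0 < s) (hs1 : s < 1) (hm : c m = AffineMap.lineMap (c i) (c k) s)
    {z : ℕ} (hz : i ≤ z ∧ z ≤ k) : orient (c i) (c k) (c z) = 0 := by
  have hz' := h.orient_nonpos_of_mem_Icc hz hk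
  rcases le_total z m with hzm | hmz
  · have h1 := h.orient_nonneg hzm hmk.le hk
    have := orient_lineMap_lineMap (c i) (c k) (c z) s 1
    rw [AffineMap.lineMap_apply_one, ← hm] at this
    rw [← orient_rotate, this] at h1
    nlinarith
  · have h1 := h.orient_nonneg him.le hmz (hz.2.trans_lt hk)
    have := orient_lineMap_lineMap (c i) (c k) (c z) 0 s
    rw [AffineMap.lineMap_apply_zero, ← hm, sub_zero] at this
    rw [this] at h1
    nlinarith

/-- If the arc from `i` to `k` has a witness `W` strictly on the other side of the chord and one of
its inner points lies on the chord, then the whole arc is flat. -/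
theorem orient_eq_zero_of_flat (h : IsConvexSeq c n) {i k m : ℕ} (him : i < m) (hmk : m < k)
    (hk : k < n) {W : Plane} (hW : ∀ x y, i ≤ x → x < y → y ≤ k → 0 ≤ orient (c x) (c y) W)
    (hW' : 0 < orient (c i) (c k) W) (hm : orient (c i) (c k) (c m) = 0)
    {z : ℕ} (hz : i ≤ z ∧ z ≤ k) : orient (c i) (c k) (c z) = 0 := by
  have hik : c i ≠ c k := fun e => by have := h.inj i k (by omega) hk e; omega
  obtain ⟨s, hs⟩ := exists_lineMap_of_orient_eq_zero hik hm
  have h0 := orient_lineMap_lineMap (c i) (c k) W 0 s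
  have h1 := orient_lineMap_lineMap (c i) (c k) W s 1
  rw [← hs, AffineMap.lineMap_apply_zero, sub_zero] at h0
  rw [← hs, AffineMap.lineMap_apply_one] at h1
  have h0' := hW i m le_rfl him hmk.le
  have h1' := hW m k him.le hmk le_rfl
  rw [h0] at h0'
  rw [h1] at h1'
  have hs0 : 0 ≤ s := nonneg_of_mul_nonneg_left h0' hW'
  have hs1 : 0 ≤ 1 - s := nonneg_of_mul_nonneg_left h1' hW'
  refine h.orient_eq_zero_of_between him hmk hk (lt_of_le_of_ne hs0 ?_)
    (lt_of_le_of_ne (by linarith) ?_) hs hz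
  · rintro rfl
    rw [AffineMap.lineMap_apply_zero] at hs
    have := h.inj _ _ (by omega) (by omega) hs; omega
  · rintro rfl
    rw [AffineMap.lineMap_apply_one] at hs
    have := h.inj _ _ (by omega) (by omega) hs; omega

/-- The diagonals of a weakly convex quadrilateral meet. The point `W`, off one of the diagonals,
takes care of the case in which the four vertices are collinear. -/
theorem exists_mem_segment_inter (h : IsConvexSeq c n) {p q r s : ℕ} (hpq : p < q) (hqr : q < r)
    (hrs : r < s) (hs : s < n) {W : Plane}
    (hW : ∀ x y, p ≤ x → x < y → y ≤ s → 0 ≤ orient (c x) (c y) W)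
    (hW' : orient (c p) (c r) W ≠ 0 ∨ orient (c q) (c s) W ≠ 0) :
    ∃ X, X ∈ segment ℝ (c p) (c r) ∧ X ∈ segment ℝ (c q) (c s) := by
  have h1 := h.nonneg p q r hpq hqr (by omega)
  have h2 := h.nonneg p r s (by omega) hrs hs
  have h3 := h.nonneg p q s hpq (by omega) hs
  have h4 := h.nonneg q r s hqr hrs hs
  have hT : orient (c p) (c q) (c r) + orient (c p) (c r) (c s) =
    orient (c p) (c q) (c s) + orient (c q) (c r) (c s) := by simp only [orient]; ring
  rcases (add_nonneg h1 h2).eq_or_lt with h0 | h0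
  · have hqs : c q ≠ c s := fun e => by have := h.inj q s (by omega) hs e; omega
    have e3 : orient (c q) (c s) (c p) = 0 := by rw [orient_rotate]; linarith
    have e4 : orient (c q) (c s) (c r) = 0 := by rw [orient_swap_right]; linarith
    have hW0 : orient (c q) (c s) W ≠ 0 := by
      rcases hW' with hW' | hW'
      · exact fun e => hW' (orient_eq_zero_of_three hqs e3 e4 e)
      · exact hW'
    have hWpos := lt_of_le_of_ne (hW q s hpq.le (by omega) le_rfl) hW0.symm
    obtain ⟨u, hu⟩ := exists_lineMap_of_orient_eq_zero hqs e4
    have g0 := orient_lineMap_lineMap (c q) (c s) W 0 u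
    have g1 := orient_lineMap_lineMap (c q) (c s) W u 1
    rw [← hu, AffineMap.lineMap_apply_zero, sub_zero] at g0
    rw [← hu, AffineMap.lineMap_apply_one] at g1
    have g0' := hW q r hpq.le hqr hrs.le
    have g1' := hW r s (by omega) hrs le_rfl
    rw [g0] at g0'
    rw [g1] at g1'
    have hu0 : 0 ≤ u := nonneg_of_mul_nonneg_left g0' hWpos
    have hu1 : 0 ≤ 1 - u := nonneg_of_mul_nonneg_left g1' hWpos
    refine ⟨c r, right_mem_segment _ _ _, ?_⟩
    rw [segment_eq_image_lineMap]
    exact ⟨u, ⟨hu0, by linarith⟩, hu.symm⟩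
  · set T := orient (c p) (c q) (c r) + orient (c p) (c r) (c s) with hTdef
    refine ⟨(orient (c p) (c r) (c s) / T) • c q + (orient (c p) (c q) (c r) / T) • c s, ?_,
      ⟨_, _, by positivity, by positivity, ?_, rfl⟩⟩
    · refine ⟨orient (c q) (c r) (c s) / T, orient (c p) (c q) (c s) / T, by positivity,
        by positivity, ?_, ?_⟩
      · rw [← add_div, div_eq_one_iff_eq h0.ne']; linarith
      · apply plane_ext <;> simp only [PiLp.add_apply, PiLp.smul_apply, smul_eq_mul] <;>
          field_simp <;> simp only [orient] <;> ring
    · rw [← add_div, div_eq_one_iff_eq h0.ne']; linarith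

end IsConvexSeq

/-! ### Moment functionals and arc polynomials -/

/-- The linear functional on polynomials with prescribed values `w k` on the monomials `X ^ k`. -/
def moment (w : ℕ → ℤ) : ℤ[X] →ₗ[ℤ] ℤ := Polynomial.lsum fun k => w k • LinearMap.id

theorem moment_apply (w : ℕ → ℤ) (p : ℤ[X]) : moment w p = p.sum fun k c => w k * c := by
  simp [moment, Polynomial.lsum_apply]

@[simp] theorem moment_X_pow (w : ℕ → ℤ) (k : ℕ) : moment w (Polynomial.X ^ k) = w k := by
  rw [moment_apply, ← Polynomial.monomial_one_right_eq_X_pow,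
    Polynomial.sum_monomial_index _ _ (by simp)]
  simp

theorem linearMap_ext_X_pow {φ ψ : ℤ[X] →ₗ[ℤ] ℤ}
    (h : ∀ k : ℕ, φ (Polynomial.X ^ k) = ψ (Polynomial.X ^ k)) : φ = ψ := by
  refine Polynomial.lhom_ext' fun k => LinearMap.ext_ring ?_
  simpa [Polynomial.monomial_one_right_eq_X_pow] using h k

/-- Multiplication by `X` followed by a functional. -/
def shift (ψ : ℤ[X] →ₗ[ℤ] ℤ) : ℤ[X] →ₗ[ℤ] ℤ := ψ ∘ₗ LinearMap.mulLeft ℤ Polynomial.X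

@[simp] theorem shift_apply (ψ : ℤ[X] →ₗ[ℤ] ℤ) (q : ℤ[X]) : shift ψ q = ψ (Polynomial.X * q) := rfl

/-- The functional `X ^ k ↦ ∑_{a + b = k} φ (X ^ a) ψ (X ^ b)`. -/
def convolution (φ ψ : ℤ[X] →ₗ[ℤ] ℤ) : ℤ[X] →ₗ[ℤ] ℤ :=
  moment fun k => ∑ p ∈ antidiagonal k,
    φ (Polynomial.X ^ p.1) * ψ (Polynomial.X ^ p.2)

theorem convolution_X_mul (φ ψ : ℤ[X] →ₗ[ℤ] ℤ) (q : ℤ[X]) :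
    convolution φ ψ (Polynomial.X * q) =
      φ (Polynomial.X * q) * ψ 1 + convolution φ (shift ψ) q := by
  have : shift (convolution φ ψ) = ψ 1 • shift φ + convolution φ (shift ψ) := by
    refine linearMap_ext_X_pow fun k => ?_
    simp only [shift_apply, LinearMap.add_apply, LinearMap.smul_apply, convolution, ← pow_succ',
      moment_X_pow, Finset.Nat.sum_antidiagonal_succ', smul_eq_mul]
    simp only [pow_zero]
    ring
  have h := LinearMap.congr_fun this q
  simp only [shift_apply, LinearMap.add_apply, LinearMap.smul_apply, smul_eq_mul] at h
  rw [h]; ring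

/-- The product of the edge polynomials of the arc of length `d` starting at `i`, the edges being
the maximal runs between indices with `ε = 0`; `ε m = 1` says that the index `m` is flat. It is
given by the three-term recurrence that comes from the recurrence of the edge polynomials. -/
def arcPoly (ε : ℕ → ℤ) (i : ℕ) : ℕ → ℤ[X]
  | 0 => 1
  | 1 => Polynomial.X
  | d + 2 => Polynomial.X * (arcPoly ε i (d + 1) - ε (i + d + 1) • arcPoly ε i d)

/-- Splitting an arc at all its points amounts to a convolution; this reflects the identity
`(x - y) ∑ P[i,k](x) P[k,j](y) = x P[i,j](x) - y P[i,j](y)`. -/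
theorem sum_arcPoly_eq_convolution (ε : ℕ → ℤ) (i : ℕ) (φ : ℤ[X] →ₗ[ℤ] ℤ) (d : ℕ) :
    ∀ ψ : ℤ[X] →ₗ[ℤ] ℤ,
      ∑ p ∈ antidiagonal d, φ (arcPoly ε i p.1) * ψ (arcPoly ε (i + p.1) p.2) =
        convolution φ ψ (arcPoly ε i d) := by
  induction d using Nat.twoStepInduction with
  | zero =>
    intro ψ
    have := moment_X_pow (fun k => ∑ p ∈ antidiagonal k,
      φ (Polynomial.X ^ p.1) * ψ (Polynomial.X ^ p.2)) 0
    rw [pow_zero] at this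
    simp [arcPoly, convolution, this]
  | one =>
    intro ψ
    have := moment_X_pow (fun k => ∑ p ∈ antidiagonal k,
      φ (Polynomial.X ^ p.1) * ψ (Polynomial.X ^ p.2)) 1
    rw [pow_one] at this
    simp [arcPoly, convolution, this, Finset.Nat.antidiagonal_succ]
  | more d ih0 ih1 =>
    intro ψ
    have e1 := ih1 (shift ψ)
    rw [Finset.Nat.sum_antidiagonal_succ'] at e1
    have key : ∑ p ∈ antidiagonal d,
        φ (arcPoly ε i p.1) * ψ (arcPoly ε (i + p.1) (p.2 + 2)) =
        ∑ p ∈ antidiagonal d,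
          φ (arcPoly ε i p.1) * shift ψ (arcPoly ε (i + p.1) (p.2 + 1)) -
        ε (i + d + 1) * ∑ p ∈ antidiagonal d,
          φ (arcPoly ε i p.1) * shift ψ (arcPoly ε (i + p.1) p.2) := by
      rw [Finset.mul_sum, ← Finset.sum_sub_distrib]
      refine Finset.sum_congr rfl fun p hp => ?_
      rw [mem_antidiagonal] at hp
      have : i + p.1 + p.2 + 1 = i + d + 1 := by omega
      simp only [arcPoly, this, shift_apply, mul_sub, map_sub, mul_smul_comm, map_smul, smul_eq_mul]
      ring
    rw [ih0] at key
    rw [Finset.Nat.sum_antidiagonal_succ', Finset.Nat.sum_antidiagonal_succ', key]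
    simp only [arcPoly]
    rw [convolution_X_mul, map_sub, map_smul, ← e1]
    simp only [arcPoly, shift_apply, mul_one, smul_eq_mul]
    ring

/-- The functional `X ^ k ↦ C_{k-1}`, with value `0` on constants. -/
def arcFun : ℤ[X] →ₗ[ℤ] ℤ := moment fun k => if k = 0 then 0 else (catalan (k - 1) : ℤ)

/-- The functional `X ^ k ↦ C_{k-2}`, with value `0` in degree less than two. -/
def polygonFun : ℤ[X] →ₗ[ℤ] ℤ := moment fun k => if k < 2 then 0 else (catalan (k - 2) : ℤ)

theorem polygonFun_X_mul (q : ℤ[X]) : polygonFun (Polynomial.X * q) = arcFun q := by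
  have : shift polygonFun = arcFun := by
    refine linearMap_ext_X_pow fun k => ?_
    simp only [shift_apply, ← pow_succ', polygonFun, arcFun, moment_X_pow]
    rcases k with _ | k
    · simp
    · simp
  exact LinearMap.congr_fun this q

@[simp] theorem arcFun_one : arcFun 1 = 0 := by
  have := moment_X_pow (fun k => if k = 0 then 0 else (catalan (k - 1) : ℤ)) 0
  simpa [arcFun] using this

@[simp] theorem arcFun_X : arcFun Polynomial.X = 1 := by
  have := moment_X_pow (fun k => if k = 0 then 0 else (catalan (k - 1) : ℤ)) 1
  simpa [arcFun] using this

/-- The Catalan recurrence as an identity between functionals. -/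
theorem convolution_arcFun (q : ℤ[X]) : convolution arcFun arcFun q = arcFun q - q.coeff 1 := by
  have : convolution arcFun arcFun = arcFun - Polynomial.lcoeff ℤ 1 := by
    refine linearMap_ext_X_pow fun k => ?_
    simp only [convolution, LinearMap.sub_apply, arcFun, moment_X_pow, Polynomial.lcoeff_apply,
      Polynomial.coeff_X_pow]
    rcases k with _ | _ | k
    · simp
    · simp [Finset.Nat.antidiagonal_succ]
    · rw [Finset.Nat.sum_antidiagonal_succ', Finset.Nat.sum_antidiagonal_succ]
      simp [catalan_succ', Nat.cast_sum]
  rw [this]; rfl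

/-- The number that the edge polynomials of the arc from `i` to `j` assign to it; by
`hasCount_arcCount` it counts the triangulations of the arc. -/
def arcCount (ε : ℕ → ℤ) (i j : ℕ) : ℤ := arcFun (arcPoly ε i (j - i))

theorem arcCount_succ (ε : ℕ → ℤ) (i : ℕ) : arcCount ε i (i + 1) = 1 := by
  simp [arcCount, arcPoly]

theorem arcPoly_coeff_zero (ε : ℕ → ℤ) (i d : ℕ) : (arcPoly ε i (d + 1)).coeff 0 = 0 := by
  rcases d with _ | d <;> simp [arcPoly]

theorem sum_arcCount (ε : ℕ → ℤ) {i j : ℕ} (hij : i + 2 ≤ j)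
    (h : i + 2 = j → ε (i + 1) = 0) :
    ∑ k ∈ Finset.Ioo i j, arcCount ε i k * arcCount ε k j = arcCount ε i j := by
  obtain ⟨d, rfl⟩ := Nat.exists_eq_add_of_le hij
  have h1 := sum_arcPoly_eq_convolution ε i arcFun (d + 2) arcFun
  rw [convolution_arcFun] at h1
  have h2 : (arcPoly ε i (d + 2)).coeff 1 = 0 := by
    rcases d with _ | d
    · simp only [arcPoly, Polynomial.coeff_X_mul]
      simp [h rfl]
    · rw [arcPoly, Polynomial.coeff_X_mul, Polynomial.coeff_sub, Polynomial.coeff_smul,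
        arcPoly_coeff_zero, arcPoly_coeff_zero, smul_zero, sub_zero]
  rw [h2, sub_zero, Finset.Nat.sum_antidiagonal_succ', Finset.Nat.sum_antidiagonal_succ] at h1
  simp only [arcPoly, arcFun_one, mul_zero, add_zero, zero_mul, zero_add] at h1
  rw [arcCount, show i + 2 + d - i = d + 2 by omega, arcPoly, ← h1]
  refine Finset.sum_nbij' (fun k => (k - i - 1, i + 2 + d - k - 1)) (fun p => i + p.1 + 1)
    ?_ ?_ ?_ ?_ ?_
  · intro k hk; simp only [Finset.mem_Ioo, mem_antidiagonal] at *; omega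
  · intro k hk; simp only [Finset.mem_Ioo, mem_antidiagonal] at *; omega
  · intro k hk; simp only [Finset.mem_Ioo] at *; omega
  · rintro ⟨k, m⟩ hk; simp only [mem_antidiagonal, Prod.mk.injEq] at *; omega
  · intro k hk
    simp only [Finset.mem_Ioo] at hk
    have e1 : k - i = k - i - 1 + 1 := by omega
    have e2 : i + 2 + d - k = i + 2 + d - k - 1 + 1 := by omega
    have e3 : k = i + (k - i - 1 + 1) := by omega
    simp only [arcCount]
    rw [← e1, ← e2, ← show k = i + (k - i) by omega]

theorem arcCount_eq_zero_of_flat (ε : ℕ → ℤ) {i j : ℕ} (hij : i + 2 ≤ j)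
    (h : ∀ m, i < m → m < j → ε m = 1) : arcCount ε i j = 0 := by
  induction hd : j - i using Nat.strong_induction_on generalizing i j with
  | _ d ih =>
    rcases hij.eq_or_lt with rfl | hij'
    · simp only [arcCount, show i + 2 - i = 2 by omega, arcPoly]
      rw [h (i + 0 + 1) (by omega) (by omega)]
      have := moment_X_pow (fun k => if k = 0 then 0 else (catalan (k - 1) : ℤ)) 2
      simp [mul_sub, ← pow_two, arcFun] at this ⊢
      have h1 := arcFun_X
      rw [arcFun] at h1
      simp [h1]
    · rw [← sum_arcCount ε hij (by omega)]
      refine Finset.sum_eq_zero fun k hk => ?_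
      rw [Finset.mem_Ioo] at hk
      by_cases hk' : i + 2 ≤ k
      · rw [ih (k - i) (by omega) hk' (fun m h1 h2 => h m h1 (by omega)) rfl, zero_mul]
      · rw [ih (j - k) (by omega) (by omega) (fun m h1 h2 => h m (by omega) h2) rfl, mul_zero]

/-- The sum over the third vertices `k` of the triangle on the root chord from `0` to `n - 1`. The
last side starts at `A` and contains `0` and `n - 1`, so that only `k < A` occurs. The missing terms
with `A ≤ k` vanish except for `k = n - 2`, which accounts for the second term of the recurrence of
`arcPoly`. -/
theorem sum_arcCount_root (ε : ℕ → ℤ) {n A : ℕ} (hAn : A < n) {m : ℕ} (hm0 : 0 < m) (hmA : m < A)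
    (hm : ε m = 0) (hA : ε A = 0) (h : ∀ m, A < m → m < n → ε m = 1) :
    ∑ k ∈ Finset.Ioo 0 A, arcCount ε 0 k * arcCount ε k (n - 1) = polygonFun (arcPoly ε 0 n) := by
  obtain ⟨d, rfl⟩ : ∃ d, n = d + 3 := ⟨n - 3, by omega⟩
  rw [arcPoly, polygonFun_X_mul, map_sub, map_smul, smul_eq_mul, show d + 3 - 1 = d + 2 by omega]
  have hs := sum_arcCount ε (i := 0) (j := d + 2) (by omega) (fun hd => by
    have : m = 1 := by omega
    rwa [this] at hm)
  have e1 : arcFun (arcPoly ε 0 (d + 2)) = arcCount ε 0 (d + 2) := rfl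
  have e2 : arcFun (arcPoly ε 0 (d + 1)) = arcCount ε 0 (d + 1) := rfl
  simp only [Nat.zero_add]
  rw [e1, e2, ← hs]
  by_cases hd : A = d + 2
  · subst hd
    rw [show d + 1 + 1 = d + 2 from rfl, hA]; ring
  · rw [h (d + 1 + 1) (by omega) (by omega), one_mul, eq_sub_iff_add_eq,
      ← Finset.sum_sdiff (Finset.Ioo_subset_Ioo_right (a := 0) (show A ≤ d + 2 by omega)), add_comm]
    congr 1
    rw [Finset.sum_eq_single (d + 1)]
    · rw [arcCount_succ, mul_one]
    · intro k hk hk'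
      simp only [Finset.mem_sdiff, Finset.mem_Ioo] at hk
      rw [arcCount_eq_zero_of_flat ε (i := k) (by omega) (fun m h1 h2 => h m (by omega) (by omega)),
        mul_zero]
    · intro hk
      simp only [Finset.mem_sdiff, Finset.mem_Ioo] at hk
      omega

/-! ### Edge polynomials -/

theorem edgePoly_eq_sum_antidiagonal (m : ℕ) : edgePoly m =
    ∑ p ∈ antidiagonal m,
      Polynomial.C ((-1 : ℤ) ^ p.2 * (p.1.choose p.2 : ℤ)) * Polynomial.X ^ p.1 := by
  rw [← Finset.Nat.sum_antidiagonal_swap, Finset.Nat.sum_antidiagonal_eq_sum_range_succ_mk, edgePoly]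
  refine Finset.sum_subset (fun k hk => ?_) fun k hk hk' => ?_
  · simp only [Finset.mem_range] at *; omega
  · simp only [Finset.mem_range] at *
    rw [Nat.choose_eq_zero_of_lt (by omega)]; simp

@[simp] theorem edgePoly_zero : edgePoly 0 = 1 := by simp [edgePoly]

@[simp] theorem edgePoly_one : edgePoly 1 = Polynomial.X := by simp [edgePoly]

theorem edgePoly_add_two (m : ℕ) :
    edgePoly (m + 2) = Polynomial.X * (edgePoly (m + 1) - edgePoly m) := by
  simp only [edgePoly_eq_sum_antidiagonal]
  rw [Finset.Nat.sum_antidiagonal_succ, Finset.Nat.sum_antidiagonal_succ',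
    Finset.Nat.sum_antidiagonal_succ' (n := m)]
  have key : ∀ p ∈ antidiagonal m,
      Polynomial.C ((-1 : ℤ) ^ (p.2 + 1) * ((p.1 + 1).choose (p.2 + 1) : ℤ)) *
          Polynomial.X ^ (p.1 + 1) =
        Polynomial.X * (Polynomial.C ((-1 : ℤ) ^ (p.2 + 1) * (p.1.choose (p.2 + 1) : ℤ)) *
          Polynomial.X ^ p.1) -
        Polynomial.X * (Polynomial.C ((-1 : ℤ) ^ p.2 * (p.1.choose p.2 : ℤ)) *
          Polynomial.X ^ p.1) := by
    intro p _
    rw [Nat.choose_succ_succ', Nat.cast_add, pow_succ]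
    simp only [map_mul, map_add, map_neg, map_one]
    ring
  rw [Finset.sum_congr rfl key, Finset.sum_sub_distrib, ← Finset.mul_sum, ← Finset.mul_sum]
  simp only [Nat.choose_zero_succ, pow_zero, Nat.choose_zero_right, Nat.cast_zero, Nat.cast_one,
    mul_zero, map_zero, mul_one, map_one]
  ring

theorem arcPoly_add (ε : ℕ → ℤ) {x s : ℕ} (hx : 0 < x → ε x = 0)
    (h : ∀ m, x < m → m < x + s → ε m = 1) :
    arcPoly ε 0 (x + s) = arcPoly ε 0 x * edgePoly s := by
  induction s using Nat.twoStepInduction with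
  | zero => simp
  | one =>
    rcases x with _ | x
    · simp [arcPoly]
    · simp only [arcPoly, edgePoly_one]
      rw [Nat.zero_add, hx (by omega)]; simp [mul_comm]
  | more s ih0 ih1 =>
    rw [← add_assoc, arcPoly, add_assoc, ih0 (fun m h1 h2 => h m h1 (by omega)),
      ih1 (fun m h1 h2 => h m h1 (by omega)), edgePoly_add_two, Nat.zero_add,
      h (x + s + 1) (by omega) (by omega)]
    rw [one_smul]; ring

theorem pairing_eq_polygonFun (p : ℤ[X]) :
    pairing p (PowerSeries.X ^ 2 * genCatalan) = polygonFun p := by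
  rw [pairing, polygonFun, moment_apply]
  refine Finset.sum_congr rfl fun k _ => ?_
  simp only [PowerSeries.coeff_X_pow_mul']
  rw [mul_comm]
  by_cases hk : 2 ≤ k
  · simp [hk, genCatalan, not_lt.2 hk]
  · simp [hk, not_le.1 hk]

theorem polygonFun_eq_sum_Icc (p : ℤ[X]) :
    polygonFun p = ∑ k ∈ Finset.Icc 2 p.natDegree, p.coeff k * (catalan (k - 2) : ℤ) := by
  rw [polygonFun, moment_apply, Polynomial.sum_over_range _ (by simp)]
  symm
  refine Finset.sum_subset_zero_on_sdiff (fun k hk => ?_) (fun k hk => ?_) fun k hk => ?_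
  · simp only [Finset.mem_Icc, Finset.mem_range] at *; omega
  · simp only [Finset.mem_sdiff, Finset.mem_Icc, Finset.mem_range] at hk
    rw [if_pos (by omega), zero_mul]
  · simp only [Finset.mem_Icc] at hk
    rw [if_neg (by omega), mul_comm]

/-! ### Recursive triangulations of arcs -/

/-- `IsArcTri N i j T`: the set `T` of index triples is a triangulation of the polygon
`i, i + 1, …, j`, described recursively by the triangle `{i, k, j}` on the chord from `i` to `j` and
the triangulations it leaves on the arcs `i, …, k` and `k, …, j`; only triangles with `N i k j` are
allowed. An arc of length one has the empty triangulation. -/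
inductive IsArcTri (N : ℕ → ℕ → ℕ → Prop) : ℕ → ℕ → Finset (Finset ℕ) → Prop
  | edge (i : ℕ) : IsArcTri N i (i + 1) ∅
  | node {i k j : ℕ} {T₁ T₂ : Finset (Finset ℕ)} (hik : i < k) (hkj : k < j) (hN : N i k j)
      (h₁ : IsArcTri N i k T₁) (h₂ : IsArcTri N k j T₂) :
      IsArcTri N i j (insert {i, k, j} (T₁ ∪ T₂))

namespace IsArcTri

variable {N : ℕ → ℕ → ℕ → Prop} {i j : ℕ} {T : Finset (Finset ℕ)}

theorem lt (h : IsArcTri N i j T) : i < j := by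
  cases h with
  | edge => exact Nat.lt_succ_self _
  | node hik hkj => exact hik.trans hkj

theorem subset_Icc (h : IsArcTri N i j T) : ∀ t ∈ T, t ⊆ Finset.Icc i j := by
  induction h with
  | edge => simp
  | @node i k j T₁ T₂ hik hkj hN h₁ h₂ ih₁ ih₂ =>
    intro t ht
    rw [Finset.mem_insert, Finset.mem_union] at ht
    rcases ht with rfl | ht | ht
    · intro x hx
      simp only [Finset.mem_insert, Finset.mem_singleton] at hx
      rw [Finset.mem_Icc]; omega
    · exact (ih₁ t ht).trans (Finset.Icc_subset_Icc_right hkj.le)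
    · exact (ih₂ t ht).trans (Finset.Icc_subset_Icc_left hik.le)

theorem exists_eq_triple (h : IsArcTri N i j T) :
    ∀ t ∈ T, ∃ x y z, x < y ∧ y < z ∧ N x y z ∧ t = {x, y, z} := by
  induction h with
  | edge => simp
  | @node i k j T₁ T₂ hik hkj hN h₁ h₂ ih₁ ih₂ =>
    intro t ht
    rw [Finset.mem_insert, Finset.mem_union] at ht
    rcases ht with rfl | ht | ht
    · exact ⟨i, k, j, hik, hkj, hN, rfl⟩
    · exact ih₁ t ht
    · exact ih₂ t ht

end IsArcTri

theorem card_triple {x y z : ℕ} (hxy : x < y) (hyz : y < z) : ({x, y, z} : Finset ℕ).card = 3 :=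
  Finset.card_eq_three.2 ⟨x, y, z, by omega, by omega, by omega, rfl⟩

theorem exists_eq_triple_of_card {t : Finset ℕ} (ht : t.card = 3) :
    ∃ x y z, x < y ∧ y < z ∧ t = {x, y, z} := by
  obtain ⟨x, y, z, hxy, hxz, hyz, rfl⟩ := Finset.card_eq_three.1 ht
  have aux : ∀ a b c : ℕ, a < b → b < c → ({a, b, c} : Finset ℕ) = {x, y, z} →
      ∃ x' y' z', x' < y' ∧ y' < z' ∧ ({x, y, z} : Finset ℕ) = {x', y', z'} :=
    fun a b c h1 h2 h => ⟨a, b, c, h1, h2, h.symm⟩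
  rcases lt_or_gt_of_ne hxy with h1 | h1 <;> rcases lt_or_gt_of_ne hxz with h2 | h2 <;>
    rcases lt_or_gt_of_ne hyz with h3 | h3
  · exact aux x y z h1 h3 rfl
  · exact aux x z y h2 h3 (by ext; simp; tauto)
  · omega
  · exact aux z x y h2 h1 (by ext; simp; tauto)
  · exact aux y x z h1 h2 (by ext; simp; tauto)
  · omega
  · exact aux y z x h3 h2 (by ext; simp; tauto)
  · exact aux z y x h3 h1 (by ext; simp; tauto)

/-- A triple does not fit into two arcs that share only one index. -/
theorem not_subset_Icc_of_card {t : Finset ℕ} (ht : t.card = 3) {i k j : ℕ}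
    (h1 : t ⊆ Finset.Icc i k) (h2 : t ⊆ Finset.Icc k j) : False := by
  have : t ⊆ {k} := fun x hx => by
    have h1 := Finset.mem_Icc.1 (h1 hx)
    have h2 := Finset.mem_Icc.1 (h2 hx)
    rw [Finset.mem_singleton]; omega
  have := Finset.card_le_card this
  rw [Finset.card_singleton] at this
  omega

/-- There are exactly `m` triangulations of the arc from `i` to `j`. -/
def HasCount (N : ℕ → ℕ → ℕ → Prop) (i j : ℕ) (m : ℤ) : Prop :=
  ∃ S : Finset (Finset (Finset ℕ)), (∀ T, T ∈ S ↔ IsArcTri N i j T) ∧ (S.card : ℤ) = m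

theorem HasCount.edge (N : ℕ → ℕ → ℕ → Prop) (i : ℕ) : HasCount N i (i + 1) 1 := by
  refine ⟨{∅}, fun T => ?_, by simp⟩
  rw [Finset.mem_singleton]
  constructor
  · rintro rfl; exact .edge i
  · intro h
    cases h with
    | edge => rfl
    | node hik hkj => omega

theorem insert_filter_left {i k j : ℕ} {T₁ T₂ : Finset (Finset ℕ)} (hkj : k < j)
    (h₁ : ∀ t ∈ T₁, t ⊆ Finset.Icc i k)
    (h₂ : ∀ t ∈ T₂, t ⊆ Finset.Icc k j) (h₂' : ∀ t ∈ T₂, t.card = 3) :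
    (insert {i, k, j} (T₁ ∪ T₂)).filter (· ⊆ Finset.Icc i k) = T₁ := by
  ext t
  simp only [Finset.mem_filter, Finset.mem_insert, Finset.mem_union]
  constructor
  · rintro ⟨rfl | ht | ht, h⟩
    · have := Finset.mem_Icc.1 (h (show j ∈ ({i, k, j} : Finset ℕ) by simp)); omega
    · exact ht
    · exact (not_subset_Icc_of_card (h₂' t ht) h (h₂ t ht)).elim
  · exact fun ht => ⟨Or.inr (Or.inl ht), h₁ t ht⟩

theorem insert_filter_right {i k j : ℕ} {T₁ T₂ : Finset (Finset ℕ)} (hik : i < k)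
    (h₁ : ∀ t ∈ T₁, t ⊆ Finset.Icc i k) (h₁' : ∀ t ∈ T₁, t.card = 3)
    (h₂ : ∀ t ∈ T₂, t ⊆ Finset.Icc k j) :
    (insert {i, k, j} (T₁ ∪ T₂)).filter (· ⊆ Finset.Icc k j) = T₂ := by
  ext t
  simp only [Finset.mem_filter, Finset.mem_insert, Finset.mem_union]
  constructor
  · rintro ⟨rfl | ht | ht, h⟩
    · have := Finset.mem_Icc.1 (h (show i ∈ ({i, k, j} : Finset ℕ) by simp)); omega
    · exact (not_subset_Icc_of_card (h₁' t ht) (h₁ t ht) h).elim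
    · exact ht
  · exact fun ht => ⟨Or.inr (Or.inr ht), h₂ t ht⟩

theorem IsArcTri.card_eq {N : ℕ → ℕ → ℕ → Prop} {i j : ℕ} {T : Finset (Finset ℕ)}
    (h : IsArcTri N i j T) : ∀ t ∈ T, t.card = 3 := by
  intro t ht
  obtain ⟨x, y, z, hxy, hyz, -, rfl⟩ := h.exists_eq_triple t ht
  exact card_triple hxy hyz

open Classical in
/-- A triangulation of an arc of length at least two is determined by its triangle on the chord and
the triangulations of the two remaining arcs. -/
theorem HasCount.node {N : ℕ → ℕ → ℕ → Prop} {i j : ℕ} (hij : i + 2 ≤ j) {g₁ g₂ : ℕ → ℤ}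
    (h₁ : ∀ k ∈ Finset.Ioo i j, N i k j → HasCount N i k (g₁ k))
    (h₂ : ∀ k ∈ Finset.Ioo i j, N i k j → HasCount N k j (g₂ k)) :
    HasCount N i j (∑ k ∈ (Finset.Ioo i j).filter (fun k => N i k j), g₁ k * g₂ k) := by
  have h₁' : ∀ k, ∃ S : Finset (Finset (Finset ℕ)), k ∈ Finset.Ioo i j → N i k j →
      (∀ T, T ∈ S ↔ IsArcTri N i k T) ∧ (S.card : ℤ) = g₁ k := by
    intro k
    by_cases hk : k ∈ Finset.Ioo i j ∧ N i k j
    · obtain ⟨S, hS⟩ := h₁ k hk.1 hk.2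
      exact ⟨S, fun _ _ => hS⟩
    · exact ⟨∅, fun a b => (hk ⟨a, b⟩).elim⟩
  have h₂' : ∀ k, ∃ S : Finset (Finset (Finset ℕ)), k ∈ Finset.Ioo i j → N i k j →
      (∀ T, T ∈ S ↔ IsArcTri N k j T) ∧ (S.card : ℤ) = g₂ k := by
    intro k
    by_cases hk : k ∈ Finset.Ioo i j ∧ N i k j
    · obtain ⟨S, hS⟩ := h₂ k hk.1 hk.2
      exact ⟨S, fun _ _ => hS⟩
    · exact ⟨∅, fun a b => (hk ⟨a, b⟩).elim⟩
  choose S₁ hS₁ using h₁'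
  choose S₂ hS₂ using h₂'
  set glue : ℕ → Finset (Finset ℕ) × Finset (Finset ℕ) → Finset (Finset ℕ) :=
    fun k p => insert {i, k, j} (p.1 ∪ p.2) with hglue
  refine ⟨((Finset.Ioo i j).filter (fun k => N i k j)).biUnion
    fun k => (S₁ k ×ˢ S₂ k).image (glue k), fun T => ?_, ?_⟩
  · simp only [Finset.mem_biUnion, Finset.mem_filter, Finset.mem_image, Finset.mem_product,
      Prod.exists]
    constructor
    · rintro ⟨k, ⟨hk, hN⟩, T₁, T₂, ⟨hT₁, hT₂⟩, rfl⟩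
      rw [(hS₁ k hk hN).1] at hT₁
      rw [(hS₂ k hk hN).1] at hT₂
      exact .node hT₁.lt hT₂.lt hN hT₁ hT₂
    · intro h
      cases h with
      | edge => omega
      | @node _ k _ T₁ T₂ hik hkj hN hT₁ hT₂ =>
        have hk : k ∈ Finset.Ioo i j := Finset.mem_Ioo.2 ⟨hik, hkj⟩
        exact ⟨k, ⟨hk, hN⟩, T₁, T₂, ⟨((hS₁ k hk hN).1 _).2 hT₁, ((hS₂ k hk hN).1 _).2 hT₂⟩, rfl⟩
  · rw [Finset.card_biUnion, Nat.cast_sum]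
    · refine Finset.sum_congr rfl fun k hk => ?_
      rw [Finset.mem_filter] at hk
      have H₁ := hS₁ k hk.1 hk.2
      have H₂ := hS₂ k hk.1 hk.2
      rw [Finset.card_image_of_injOn, Finset.card_product, Nat.cast_mul, H₁.2, H₂.2]
      rintro ⟨T₁, T₂⟩ hT ⟨U₁, U₂⟩ hU heq
      simp only [Finset.mem_coe, Finset.mem_product, H₁.1, H₂.1] at hT hU
      simp only [hglue] at heq
      have e₁ := congrArg (Finset.filter (· ⊆ Finset.Icc i k)) heq
      have e₂ := congrArg (Finset.filter (· ⊆ Finset.Icc k j)) heq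
      rw [insert_filter_left hT.2.lt hT.1.subset_Icc hT.2.subset_Icc hT.2.card_eq,
        insert_filter_left hU.2.lt hU.1.subset_Icc hU.2.subset_Icc hU.2.card_eq] at e₁
      rw [insert_filter_right hT.1.lt hT.1.subset_Icc hT.1.card_eq hT.2.subset_Icc,
        insert_filter_right hU.1.lt hU.1.subset_Icc hU.1.card_eq hU.2.subset_Icc] at e₂
      rw [e₁, e₂]
    · intro k hk k' hk' hne
      rw [Finset.mem_coe, Finset.mem_filter] at hk hk'
      rw [Function.onFun, Finset.disjoint_left]
      intro T hT hT'
      simp only [Finset.mem_image, Finset.mem_product, Prod.exists] at hT hT'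
      obtain ⟨T₁, T₂, hT, rfl⟩ := hT
      obtain ⟨U₁, U₂, hU, heq⟩ := hT'
      rw [(hS₁ k hk.1 hk.2).1, (hS₂ k hk.1 hk.2).1] at hT
      rw [(hS₁ k' hk'.1 hk'.2).1, (hS₂ k' hk'.1 hk'.2).1] at hU
      have hmem : ({i, k, j} : Finset ℕ) ∈ glue k' (U₁, U₂) := by
        rw [heq]; exact Finset.mem_insert_self _ _
      have hk1 := Finset.mem_Ioo.1 hk.1
      have hk1' := Finset.mem_Ioo.1 hk'.1
      simp only [hglue, Finset.mem_insert, Finset.mem_union] at hmem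
      rcases hmem with h | h | h
      · have : k ∈ ({i, k', j} : Finset ℕ) := by rw [← h]; simp
        simp only [Finset.mem_insert, Finset.mem_singleton] at this
        omega
      · have := Finset.mem_Icc.1 (hU.1.subset_Icc _ h (show j ∈ ({i, k, j} : Finset ℕ) by simp))
        omega
      · have := Finset.mem_Icc.1 (hU.2.subset_Icc _ h (show i ∈ ({i, k, j} : Finset ℕ) by simp))
        omega

/-- The number of triangulations of an arc on which a triangle `x y z` is degenerate exactly if all
indices strictly between `x` and `z` are flat. -/
theorem hasCount_arcCount {N : ℕ → ℕ → ℕ → Prop} {ε : ℕ → ℤ} (hε : ∀ m, ε m = 0 ∨ ε m = 1) {i j : ℕ}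
    (hij : i < j)
    (hN : ∀ x y z, i ≤ x → x < y → y < z → z ≤ j → (N x y z ↔ ∃ m, x < m ∧ m < z ∧ ε m = 0)) :
    HasCount N i j (arcCount ε i j) := by
  classical
  induction hd : j - i using Nat.strong_induction_on generalizing i j with
  | _ d ih =>
    obtain h1 | h1 : i + 1 = j ∨ i + 2 ≤ j := by omega
    · subst h1; rw [arcCount_succ]; exact .edge N i
    have key := HasCount.node (N := N) h1 (g₁ := fun k => arcCount ε i k)
      (g₂ := fun k => arcCount ε k j)
      (fun k hk _ => by
        rw [Finset.mem_Ioo] at hk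
        exact ih (k - i) (by omega) hk.1 (fun x y z a b c d => hN x y z a b c (by omega)) rfl)
      (fun k hk _ => by
        rw [Finset.mem_Ioo] at hk
        exact ih (j - k) (by omega) hk.2 (fun x y z a b c d => hN x y z (by omega) b c d) rfl)
    by_cases hm : ∃ m, i < m ∧ m < j ∧ ε m = 0
    · rw [Finset.filter_true_of_mem] at key
      · rwa [sum_arcCount ε h1] at key
        intro hj
        obtain ⟨m, h1, h2, h3⟩ := hm
        rwa [show i + 1 = m by omega]
      · intro k hk
        rw [Finset.mem_Ioo] at hk
        exact (hN i k j le_rfl hk.1 hk.2 le_rfl).2 hm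
    · rw [Finset.filter_false_of_mem] at key
      · rw [arcCount_eq_zero_of_flat ε h1]
        · exact key
        · intro m h1 h2
          exact (hε m).resolve_left fun h3 => hm ⟨m, h1, h2, h3⟩
      · intro k hk h
        rw [Finset.mem_Ioo] at hk
        exact hm ((hN i k j le_rfl hk.1 hk.2 le_rfl).1 h)

section Triangulations

/-! ### Maximal triangulations in terms of indices -/

/-- The convex hull of the points with indices in `t`. -/
def hull (c : ℕ → Plane) (t : Finset ℕ) : Set Plane := convexHull ℝ (c '' (t : Set ℕ))

theorem hull_mono (c : ℕ → Plane) {s t : Finset ℕ} (h : s ⊆ t) : hull c s ⊆ hull c t :=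
  convexHull_mono (Set.image_mono (Finset.coe_subset.2 h))

theorem mem_hull (c : ℕ → Plane) {t : Finset ℕ} {x : ℕ} (h : x ∈ t) : c x ∈ hull c t :=
  subset_convexHull ℝ _ ⟨x, h, rfl⟩

theorem segment_subset_hull (c : ℕ → Plane) {t : Finset ℕ} {x y : ℕ} (hx : x ∈ t) (hy : y ∈ t) :
    segment ℝ (c x) (c y) ⊆ hull c t :=
  (convex_convexHull ℝ _).segment_subset (mem_hull c hx) (mem_hull c hy)

theorem eq_of_mem_hull_of_subset_singleton {c : ℕ → Plane} {t : Finset ℕ} {x : ℕ} {p : Plane}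
    (hp : p ∈ hull c t) (ht : ∀ y ∈ t, y = x) : x ∈ t ∧ p = c x := by
  have hsub : t ⊆ {x} := fun y hy => Finset.mem_singleton.2 (ht y hy)
  have hp' := hull_mono c hsub hp
  simp only [hull, Finset.coe_singleton, Set.image_singleton, convexHull_singleton,
    Set.mem_singleton_iff] at hp'
  refine ⟨?_, hp'⟩
  rcases Finset.subset_singleton_iff.1 hsub with rfl | rfl
  · simp [hull] at hp
  · simp

theorem orient_nonneg_of_mem_hull {c : ℕ → Plane} {t : Finset ℕ} {A B p : Plane}
    (ht : ∀ x ∈ t, 0 ≤ orient A B (c x)) (hp : p ∈ hull c t) : 0 ≤ orient A B p :=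
  orient_nonneg_of_mem_convexHull (by rintro _ ⟨x, hx, rfl⟩; exact ht x hx) hp

theorem orient_nonpos_of_mem_hull {c : ℕ → Plane} {t : Finset ℕ} {A B p : Plane}
    (ht : ∀ x ∈ t, orient A B (c x) ≤ 0) (hp : p ∈ hull c t) : orient A B p ≤ 0 :=
  orient_nonpos_of_mem_convexHull (by rintro _ ⟨x, hx, rfl⟩; exact ht x hx) hp

open Classical in
theorem mem_hull_filter {c : ℕ → Plane} {t : Finset ℕ} {A B p : Plane}
    (ht : (∀ x ∈ t, 0 ≤ orient A B (c x)) ∨ (∀ x ∈ t, orient A B (c x) ≤ 0))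
    (hp : p ∈ hull c t) (h0 : orient A B p = 0) :
    p ∈ hull c (t.filter fun x => orient A B (c x) = 0) := by
  have : p ∈ convexHull ℝ (c '' (t : Set ℕ) ∩ {x | orient A B x = 0}) := by
    rcases ht with ht | ht
    · exact mem_convexHull_inter_line (by rintro _ ⟨x, hx, rfl⟩; exact ht x hx) hp h0
    · exact mem_convexHull_inter_line' (by rintro _ ⟨x, hx, rfl⟩; exact ht x hx) hp h0
  refine convexHull_mono ?_ this
  rintro _ ⟨⟨x, hx, rfl⟩, h⟩
  exact ⟨x, by simpa using ⟨hx, h⟩, rfl⟩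

/-- No three distinct indices in `t` belong to collinear points. -/
def Ndeg (c : ℕ → Plane) (t : Finset ℕ) : Prop :=
  ∀ x ∈ t, ∀ y ∈ t, ∀ z ∈ t, x ≠ y → y ≠ z → x ≠ z → orient (c x) (c y) (c z) ≠ 0

theorem ndeg_triple {c : ℕ → Plane} {x y z : ℕ} (h : orient (c x) (c y) (c z) ≠ 0) :
    Ndeg c {x, y, z} := by
  have h1 : orient (c y) (c z) (c x) ≠ 0 := by rwa [orient_rotate]
  have h2 : orient (c z) (c x) (c y) ≠ 0 := by rwa [orient_rotate]
  have h3 : orient (c y) (c x) (c z) ≠ 0 := by rwa [orient_swap, neg_ne_zero]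
  have h4 : orient (c z) (c y) (c x) ≠ 0 := by rwa [orient_swap, neg_ne_zero]
  have h5 : orient (c x) (c z) (c y) ≠ 0 := by rwa [orient_swap, neg_ne_zero]
  intro x' hx y' hy z' hz hxy hyz hxz
  simp only [Finset.mem_insert, Finset.mem_singleton] at hx hy hz
  rcases hx with rfl | rfl | rfl <;> rcases hy with rfl | rfl | rfl <;>
    rcases hz with rfl | rfl | rfl <;> first | assumption | contradiction

/-- A maximal triangulation of the points `c 0, …, c (n - 1)`, written in terms of indices. -/
structure IsIndexTri (c : ℕ → Plane) (n : ℕ) (T : Finset (Finset ℕ)) : Prop where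
  subset : ∀ t ∈ T, t ⊆ Finset.range n
  card_eq : ∀ t ∈ T, t.card = 3
  ndeg : ∀ t ∈ T, Ndeg c t
  cover : ∀ p ∈ hull c (Finset.range n), ∃ t ∈ T, p ∈ hull c t
  inter : ∀ s ∈ T, ∀ t ∈ T, s ≠ t → ∀ p, p ∈ hull c s → p ∈ hull c t → p ∈ hull c (s ∩ t)
  mem : ∀ x < n, ∃ t ∈ T, x ∈ t

/-- The triangles `x y z` that are allowed in a triangulation of `c`. -/
abbrev NonCollinear (c : ℕ → Plane) (x y z : ℕ) : Prop := orient (c x) (c y) (c z) ≠ 0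

variable {c : ℕ → Plane} {n : ℕ}

/-! ### Recursive triangulations are maximal triangulations -/

theorem IsArcTri.ndeg {i j : ℕ} {T : Finset (Finset ℕ)} (hT : IsArcTri (NonCollinear c) i j T) :
    ∀ t ∈ T, Ndeg c t := by
  intro t ht
  obtain ⟨x, y, z, -, -, h, rfl⟩ := hT.exists_eq_triple t ht
  exact ndeg_triple h

theorem IsArcTri.exists_mem {N : ℕ → ℕ → ℕ → Prop} {i j : ℕ} {T : Finset (Finset ℕ)}
    (hT : IsArcTri N i j T) : ∀ m, i < m → m < j → ∃ t ∈ T, m ∈ t := by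
  induction hT with
  | edge => intros; omega
  | @node i k j T₁ T₂ hik hkj hN h₁ h₂ ih₁ ih₂ =>
    intro m him hmj
    rcases lt_trichotomy m k with h | rfl | h
    · obtain ⟨t, ht, hm⟩ := ih₁ m him h
      exact ⟨t, by simp [ht], hm⟩
    · exact ⟨_, Finset.mem_insert_self _ _, by simp⟩
    · obtain ⟨t, ht, hm⟩ := ih₂ m h hmj
      exact ⟨t, by simp [ht], hm⟩

theorem IsConvexSeq.mem_hull_triangle (h : IsConvexSeq c n) {i k j : ℕ} (hik : i < k)
    (hkj : k < j) (hj : j < n) (hN : NonCollinear c i k j) {p : Plane}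
    (h1 : 0 ≤ orient (c i) (c k) p) (h2 : 0 ≤ orient (c k) (c j) p)
    (h3 : orient (c i) (c j) p ≤ 0) : p ∈ hull c {i, k, j} := by
  have hpos := lt_of_le_of_ne (h.nonneg i k j hik hkj hj) hN.symm
  have := mem_convexHull_triangle hpos h1 h2 (by rw [orient_swap]; linarith)
  simpa [hull, Set.image_insert_eq] using this

/-- The triangles of a triangulation of an arc cover the part of the polygon cut off by the chord:
follow the side on which the point lies. -/
theorem IsArcTri.cover_of_neg (h : IsConvexSeq c n) {i j : ℕ} {T : Finset (Finset ℕ)}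
    (hT : IsArcTri (NonCollinear c) i j T) (hj : j < n) {p : Plane}
    (hp : p ∈ hull c (Finset.range n)) (hneg : orient (c i) (c j) p < 0) :
    ∃ t ∈ T, p ∈ hull c t := by
  induction hT with
  | edge i =>
    refine absurd hneg (not_lt.2 (orient_nonneg_of_mem_hull (fun m hm => ?_) hp))
    rw [Finset.mem_range] at hm
    rcases Nat.lt_or_ge i m with him | him
    · exact h.orient_nonneg (Nat.le_succ i) him hm
    · exact h.orient_nonneg_of_le (Nat.le_succ i) him hj
  | @node i k j T₁ T₂ hik hkj hN h₁ h₂ ih₁ ih₂ =>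
    rcases lt_or_ge (orient (c i) (c k) p) 0 with g1 | g1
    · obtain ⟨t, ht, hpt⟩ := ih₁ (hkj.trans hj) g1
      exact ⟨t, by simp [ht], hpt⟩
    rcases lt_or_ge (orient (c k) (c j) p) 0 with g2 | g2
    · obtain ⟨t, ht, hpt⟩ := ih₂ hj g2
      exact ⟨t, by simp [ht], hpt⟩
    exact ⟨_, Finset.mem_insert_self _ _, h.mem_hull_triangle hik hkj hj hN g1 g2 hneg.le⟩

/-- A nondegenerate triangle on one side of the chord from `i` to `k` meets the line through the
chord only in points spanned by the ends of the chord, if the polygon has a point `W` strictly on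
the other side. -/
theorem IsConvexSeq.mem_hull_chord (h : IsConvexSeq c n) {i k : ℕ} (hk : k < n) {W : Plane}
    (hW : ∀ x y, i ≤ x → x < y → y ≤ k → 0 ≤ orient (c x) (c y) W)
    (hW' : 0 < orient (c i) (c k) W) {s : Finset ℕ} (hs : s ⊆ Finset.Icc i k) (hs3 : s.card = 3)
    (hnd : Ndeg c s) {p : Plane} (hp : p ∈ hull c s) (h0 : orient (c i) (c k) p = 0) :
    p ∈ hull c (s ∩ {i, k}) := by
  classical
  refine hull_mono c ?_ (mem_hull_filter (Or.inr fun x hx =>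
    h.orient_nonpos_of_mem_Icc (Finset.mem_Icc.1 (hs hx)) hk) hp h0)
  intro m hm
  rw [Finset.mem_filter] at hm
  have hm' := Finset.mem_Icc.1 (hs hm.1)
  rw [Finset.mem_inter, Finset.mem_insert, Finset.mem_singleton]
  refine ⟨hm.1, ?_⟩
  by_contra hne
  push Not at hne
  have hik : c i ≠ c k := fun e => by have := h.inj i k (by omega) hk e; omega
  have flat := fun z (hz : z ∈ s) => h.orient_eq_zero_of_flat (z := z) (i := i) (k := k)
    (lt_of_le_of_ne hm'.1 hne.1.symm)
    (lt_of_le_of_ne hm'.2 hne.2) hk hW hW' hm.2 (Finset.mem_Icc.1 (hs hz))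
  obtain ⟨x, y, z, hxy, hyz, rfl⟩ := exists_eq_triple_of_card hs3
  exact hnd x (by simp) y (by simp) z (by simp) hxy.ne hyz.ne (hxy.trans hyz).ne
    (orient_eq_zero_of_three hik (flat x (by simp)) (flat y (by simp)) (flat z (by simp)))

theorem IsArcTri.inter (h : IsConvexSeq c n) {i j : ℕ} {T : Finset (Finset ℕ)}
    (hT : IsArcTri (NonCollinear c) i j T) (hj : j < n) :
    ∀ s ∈ T, ∀ t ∈ T, s ≠ t → ∀ p, p ∈ hull c s → p ∈ hull c t → p ∈ hull c (s ∩ t) := by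
  induction hT with
  | edge i => simp
  | @node i k j T₁ T₂ hik hkj hN h₁ h₂ ih₁ ih₂ =>
    have hpos : 0 < orient (c i) (c k) (c j) :=
      lt_of_le_of_ne (h.nonneg i k j hik hkj hj) hN.symm
    have hpos' : 0 < orient (c k) (c j) (c i) := by rwa [orient_rotate]
    have hk : k < n := hkj.trans hj
    have chord₁ : ∀ s ∈ T₁, ∀ p ∈ hull c s, orient (c i) (c k) p = 0 →
        p ∈ hull c (s ∩ {i, k}) := fun s hs p hp h0 =>
      h.mem_hull_chord hk (W := c j) (fun x y _ hxy hy => h.orient_nonneg hxy.le (hy.trans hkj.le) hj)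
        hpos (h₁.subset_Icc s hs) (h₁.card_eq s hs) (h₁.ndeg s hs) hp h0
    have chord₂ : ∀ s ∈ T₂, ∀ p ∈ hull c s, orient (c k) (c j) p = 0 →
        p ∈ hull c (s ∩ {k, j}) := fun s hs p hp h0 =>
      h.mem_hull_chord hj (W := c i)
        (fun x y hx hxy hy => h.orient_nonneg_of_le hxy.le (hik.le.trans hx) (hy.trans_lt hj))
        hpos' (h₂.subset_Icc s hs) (h₂.card_eq s hs) (h₂.ndeg s hs) hp h0
    have side₁ : ∀ s ∈ T₁, ∀ p ∈ hull c s,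
        orient (c i) (c k) p ≤ 0 ∧ 0 ≤ orient (c k) (c j) p := fun s hs p hp =>
      ⟨orient_nonpos_of_mem_hull (fun x hx =>
        h.orient_nonpos_of_mem_Icc (Finset.mem_Icc.1 (h₁.subset_Icc s hs hx)) hk) hp,
      orient_nonneg_of_mem_hull (fun x hx =>
        h.orient_nonneg_of_le hkj.le (Finset.mem_Icc.1 (h₁.subset_Icc s hs hx)).2 hj) hp⟩
    have side₂ : ∀ s ∈ T₂, ∀ p ∈ hull c s,
        0 ≤ orient (c i) (c k) p ∧ orient (c k) (c j) p ≤ 0 := fun s hs p hp =>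
      ⟨orient_nonneg_of_mem_hull (fun x hx =>
        have hx := Finset.mem_Icc.1 (h₂.subset_Icc s hs hx)
        h.orient_nonneg hik.le hx.1 (hx.2.trans_lt hj)) hp,
      orient_nonpos_of_mem_hull (fun x hx =>
        h.orient_nonpos_of_mem_Icc (Finset.mem_Icc.1 (h₂.subset_Icc s hs hx)) hj) hp⟩
    have side : ∀ p ∈ hull c {i, k, j}, 0 ≤ orient (c i) (c k) p ∧ 0 ≤ orient (c k) (c j) p := by
      intro p hp
      constructor <;> refine orient_nonneg_of_mem_hull (fun x hx => ?_) hp <;>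
        simp only [Finset.mem_insert, Finset.mem_singleton] at hx <;>
        rcases hx with rfl | rfl | rfl <;> simp [hpos.le, hpos'.le]
    have new₁ : ∀ s ∈ T₁, ∀ p, p ∈ hull c s → p ∈ hull c {i, k, j} →
        p ∈ hull c (s ∩ {i, k, j}) := fun s hs p hp hp' =>
      hull_mono c (Finset.inter_subset_inter_left (by intro x; simp; tauto))
        (chord₁ s hs p hp (le_antisymm (side₁ s hs p hp).1 (side p hp').1))
    have new₂ : ∀ s ∈ T₂, ∀ p, p ∈ hull c s → p ∈ hull c {i, k, j} →
        p ∈ hull c (s ∩ {i, k, j}) := fun s hs p hp hp' =>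
      hull_mono c (Finset.inter_subset_inter_left (by intro x; simp; tauto))
        (chord₂ s hs p hp (le_antisymm (side₂ s hs p hp).2 (side p hp').2))
    have mixed : ∀ s ∈ T₁, ∀ t ∈ T₂, ∀ p, p ∈ hull c s → p ∈ hull c t → p ∈ hull c (s ∩ t) := by
      intro s hs t ht p hps hpt
      have e1 := le_antisymm (side₁ s hs p hps).1 (side₂ t ht p hpt).1
      have e2 := le_antisymm (side₂ t ht p hpt).2 (side₁ s hs p hps).2
      obtain rfl := eq_of_orient_eq_zero_of_orient_eq_zero hN e1 e2
      have hks : k ∈ s := by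
        by_contra hks
        have := (eq_of_mem_hull_of_subset_singleton (x := i) (chord₁ s hs _ hps e1) (by
          intro y hy
          simp only [Finset.mem_inter, Finset.mem_insert, Finset.mem_singleton] at hy
          rcases hy with ⟨hy, rfl | rfl⟩
          · rfl
          · exact absurd hy hks)).2
        have := h.inj _ _ hk (by omega) this
        omega
      have hkt : k ∈ t := by
        by_contra hkt
        have := (eq_of_mem_hull_of_subset_singleton (x := j) (chord₂ t ht _ hpt e2) (by
          intro y hy
          simp only [Finset.mem_inter, Finset.mem_insert, Finset.mem_singleton] at hy
          rcases hy with ⟨hy, rfl | rfl⟩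
          · exact absurd hy hkt
          · rfl)).2
        have := h.inj _ _ hk (by omega) this
        omega
      exact mem_hull c (Finset.mem_inter.2 ⟨hks, hkt⟩)
    intro s hs t ht hst p hps hpt
    rw [Finset.mem_insert, Finset.mem_union] at hs ht
    rcases hs with rfl | hs | hs <;> rcases ht with rfl | ht | ht
    · exact absurd rfl hst
    · rw [Finset.inter_comm]; exact new₁ t ht p hpt hps
    · rw [Finset.inter_comm]; exact new₂ t ht p hpt hps
    · exact new₁ s hs p hps hpt
    · exact ih₁ hk s hs t ht hst p hps hpt
    · exact mixed s hs t ht p hps hpt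
    · exact new₂ s hs p hps hpt
    · rw [Finset.inter_comm]; exact mixed t ht s hs p hpt hps
    · exact ih₂ hj s hs t ht hst p hps hpt

theorem IsArcTri.isIndexTri (h : IsConvexSeq c n) (hn : 3 ≤ n) {T : Finset (Finset ℕ)}
    (hT : IsArcTri (NonCollinear c) 0 (n - 1) T) : IsIndexTri c n T where
  subset t ht := (hT.subset_Icc t ht).trans fun x hx => by
    rw [Finset.mem_Icc] at hx; rw [Finset.mem_range]; omega
  card_eq := hT.card_eq
  ndeg := hT.ndeg
  inter := hT.inter h (by omega)
  cover p hp := by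
    have hle : orient (c 0) (c (n - 1)) p ≤ 0 := orient_nonpos_of_mem_hull (fun x hx =>
      h.orient_nonpos_of_mem_Icc ⟨Nat.zero_le _, by rw [Finset.mem_range] at hx; omega⟩
        (by omega)) hp
    generalize hj : n - 1 = j at hT hle
    cases hT with
    | edge => omega
    | @node _ k _ T₁ T₂ hik hkj hN h₁ h₂ =>
      have hjn : j < n := by omega
      rcases lt_or_ge (orient (c 0) (c k) p) 0 with g1 | g1
      · obtain ⟨t, ht, hpt⟩ := h₁.cover_of_neg h (hkj.trans hjn) hp g1
        exact ⟨t, by simp [ht], hpt⟩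
      rcases lt_or_ge (orient (c k) (c j) p) 0 with g2 | g2
      · obtain ⟨t, ht, hpt⟩ := h₂.cover_of_neg h hjn hp g2
        exact ⟨t, by simp [ht], hpt⟩
      exact ⟨_, Finset.mem_insert_self _ _, h.mem_hull_triangle hik hkj hjn hN g1 g2 hle⟩
  mem x hx := by
    by_cases hx' : 0 < x ∧ x < n - 1
    · exact hT.exists_mem x hx'.1 hx'.2
    generalize hj : n - 1 = j at hT
    cases hT with
    | edge => omega
    | @node _ k _ T₁ T₂ hik hkj hN h₁ h₂ =>
      refine ⟨_, Finset.mem_insert_self _ _, ?_⟩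
      simp only [Finset.mem_insert, Finset.mem_singleton]
      omega

/-! ### Maximal triangulations are recursive triangulations -/

/-- A point `c x` lying in a triangle of a maximal triangulation is a vertex of it. -/
theorem IsIndexTri.mem_of_mem_hull {T : Finset (Finset ℕ)} (hT : IsIndexTri c n T) {x : ℕ}
    (hx : x < n) {t : Finset ℕ} (ht : t ∈ T) (hxt : c x ∈ hull c t) : x ∈ t := by
  obtain ⟨s, hs, hxs⟩ := hT.mem x hx
  by_contra hxt'
  have hst : s ≠ t := by rintro rfl; exact hxt' hxs
  have hmem := hT.inter s hs t ht hst _ (mem_hull c hxs) hxt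
  obtain ⟨y, z, hyz, he⟩ := Finset.card_eq_two.1
    (show (s.erase x).card = 2 by rw [Finset.card_erase_of_mem hxs, hT.card_eq s hs])
  have hsub : s ∩ t ⊆ s.erase x := fun m hm => by
    rw [Finset.mem_inter] at hm
    rw [Finset.mem_erase]
    exact ⟨by rintro rfl; exact hxt' hm.2, hm.1⟩
  have hmem' := hull_mono c hsub hmem
  have hy : y ∈ s.erase x := by rw [he]; simp
  have hz : z ∈ s.erase x := by rw [he]; simp
  rw [Finset.mem_erase] at hy hz
  refine hT.ndeg s hs y hy.2 z hz.2 x hxs hyz hz.1 hy.1 (le_antisymm ?_ ?_)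
  · refine orient_nonpos_of_mem_hull (fun m hm => ?_) hmem'
    rw [he] at hm
    rcases Finset.mem_insert.1 hm with rfl | hm
    · simp
    · rw [Finset.mem_singleton] at hm; subst hm; simp
  · refine orient_nonneg_of_mem_hull (fun m hm => ?_) hmem'
    rw [he] at hm
    rcases Finset.mem_insert.1 hm with rfl | hm
    · simp
    · rw [Finset.mem_singleton] at hm; subst hm; simp

/-- In a nondegenerate triangle, a face not containing the vertex `w` meets the side `w z` at most
in `z`. -/
theorem mem_of_mem_hull_of_mem_segment {s u : Finset ℕ} (hs : Ndeg c s) (hs3 : s.card = 3)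
    {w z : ℕ} (hw : w ∈ s) (hz : z ∈ s) (hwz : w ≠ z) (hu : u ⊆ s) (hwu : w ∉ u) {X : Plane}
    (hX : X ∈ hull c u) (hX' : X ∈ segment ℝ (c w) (c z)) : z ∈ u ∧ X = c z := by
  classical
  have h0 : orient (c w) (c z) X = 0 := by
    rw [segment_eq_image_lineMap] at hX'
    obtain ⟨r, -, rfl⟩ := hX'
    simp [orient_lineMap]
  obtain ⟨v, hv⟩ := Finset.card_eq_one.1 (show ((s.erase w).erase z).card = 1 by
    rw [Finset.card_erase_of_mem (Finset.mem_erase.2 ⟨hwz.symm, hz⟩), Finset.card_erase_of_mem hw,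
      hs3])
  have hmem : ∀ m ∈ s, m = w ∨ m = z ∨ m = v := by
    intro m hm
    by_contra hne
    push Not at hne
    have : m ∈ (s.erase w).erase z := by simp [hne, hm]
    rw [hv, Finset.mem_singleton] at this
    exact hne.2.2 this
  have hsign : (∀ x ∈ u, 0 ≤ orient (c w) (c z) (c x)) ∨
      (∀ x ∈ u, orient (c w) (c z) (c x) ≤ 0) := by
    rcases le_total 0 (orient (c w) (c z) (c v)) with hv' | hv'
    · left
      intro x hx
      rcases hmem x (hu hx) with rfl | rfl | rfl
      · simp
      · simp
      · exact hv'
    · right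
      intro x hx
      rcases hmem x (hu hx) with rfl | rfl | rfl
      · simp
      · simp
      · exact hv'
  have := eq_of_mem_hull_of_subset_singleton (x := z) (mem_hull_filter hsign hX h0) (by
    intro m hm
    rw [Finset.mem_filter] at hm
    by_contra hne
    exact hs w hw z hz m (hu hm.1) hwz (Ne.symm hne) (by rintro rfl; exact hwu hm.1) hm.2)
  exact ⟨(Finset.mem_filter.1 this.1).1, this.2⟩

/-- The triangle on a chord separates the other triangles on that side of the chord: a triangle with
vertices on both sides would cross it. -/
theorem IsIndexTri.subset_or_subset (h : IsConvexSeq c n) {T : Finset (Finset ℕ)}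
    (hT : IsIndexTri c n T) {i k j : ℕ} (hik : i < k) (hkj : k < j) (hj : j < n)
    (ht : {i, k, j} ∈ T) {s : Finset ℕ} (hs : s ∈ T) (hsub : s ⊆ Finset.Icc i j) :
    s = {i, k, j} ∨ s ⊆ Finset.Icc i k ∨ s ⊆ Finset.Icc k j := by
  by_contra hcon
  push Not at hcon
  obtain ⟨hst, h1, h2⟩ := hcon
  rw [Finset.not_subset] at h1 h2
  obtain ⟨z, hzs, hz⟩ := h1
  obtain ⟨y, hys, hy⟩ := h2
  have hz' := Finset.mem_Icc.1 (hsub hzs)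
  have hy' := Finset.mem_Icc.1 (hsub hys)
  rw [Finset.mem_Icc] at hz hy
  have hN : orient (c i) (c k) (c j) ≠ 0 :=
    hT.ndeg _ ht i (by simp) k (by simp) j (by simp) hik.ne hkj.ne (hik.trans hkj).ne
  obtain ⟨w, hws, hwt⟩ : ∃ w ∈ s, w ∉ ({i, k, j} : Finset ℕ) := by
    rw [← Finset.not_subset]
    intro hsub'
    exact hst (Finset.eq_of_subset_of_card_le hsub' (by
      rw [hT.card_eq _ hs, hT.card_eq _ ht]))
  have hwt' := hwt
  simp only [Finset.mem_insert, Finset.mem_singleton, not_or] at hwt'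
  have hw' := Finset.mem_Icc.1 (hsub hws)
  have hwu : w ∉ s ∩ {i, k, j} := fun hmem => hwt (Finset.mem_inter.1 hmem).2
  rcases lt_or_gt_of_ne hwt'.2.1 with hwk | hwk
  · obtain ⟨X, hX, hX'⟩ := h.exists_mem_segment_inter (p := i) (q := w) (r := k) (s := z)
      (W := c j) (by omega) hwk (by omega) (by omega)
      (fun x y _ hxy hyz => h.orient_nonneg hxy.le (hyz.trans hz'.2) hj) (Or.inl hN)
    have hXu := hT.inter s hs _ ht hst X (segment_subset_hull c hws hzs hX')
      (segment_subset_hull c (by simp) (by simp) hX)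
    obtain ⟨hzu, rfl⟩ := mem_of_mem_hull_of_mem_segment (hT.ndeg s hs) (hT.card_eq s hs) hws hzs
      (by omega) Finset.inter_subset_left hwu hXu hX'
    have hzj : z = j := by
      have := (Finset.mem_inter.1 hzu).2
      simp only [Finset.mem_insert, Finset.mem_singleton] at this
      omega
    subst hzj
    rw [segment_eq_image_lineMap] at hX
    obtain ⟨r, -, hr⟩ := hX
    apply hN
    rw [← hr]; simp [orient_lineMap]
  · obtain ⟨X, hX, hX'⟩ := h.exists_mem_segment_inter (p := y) (q := k) (r := w) (s := j)
      (W := c i) (by omega) hwk (by omega) (by omega)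
      (fun x y' hx hxy hyz => h.orient_nonneg_of_le hxy.le (hy'.1.trans hx) (hyz.trans_lt hj))
      (Or.inr (by rwa [orient_rotate]))
    rw [segment_symm] at hX
    have hXu := hT.inter s hs _ ht hst X (segment_subset_hull c hws hys hX)
      (segment_subset_hull c (by simp) (by simp) hX')
    obtain ⟨hyu, rfl⟩ := mem_of_mem_hull_of_mem_segment (hT.ndeg s hs) (hT.card_eq s hs) hws hys
      (by omega) Finset.inter_subset_left hwu hXu hX
    have hyi : y = i := by
      have := (Finset.mem_inter.1 hyu).2
      simp only [Finset.mem_insert, Finset.mem_singleton] at this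
      omega
    subst hyi
    rw [segment_eq_image_lineMap] at hX'
    obtain ⟨r, -, hr⟩ := hX'
    apply hN
    rw [← orient_rotate, ← hr]; simp [orient_lineMap]

theorem isClosed_hull (c : ℕ → Plane) (t : Finset ℕ) : IsClosed (hull c t) :=
  ((t.finite_toSet.image c).isCompact_convexHull ℝ).isClosed

/-- If the points off the line `A B` in the hull of `J` are covered by finitely many triangles, then
so is the whole hull, unless it lies on that line. -/
theorem exists_mem_hull_of_forall_ne {J : Finset ℕ} {F : Finset (Finset ℕ)} {A B : Plane} {m : ℕ}
    (hm : m ∈ J) (hm0 : orient A B (c m) ≠ 0)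
    (hF : ∀ p ∈ hull c J, orient A B p ≠ 0 → ∃ t ∈ F, p ∈ hull c t) {p : Plane}
    (hp : p ∈ hull c J) : ∃ t ∈ F, p ∈ hull c t := by
  by_cases h0 : orient A B p = 0
  · have hcl : IsClosed (⋃ t ∈ F, hull c t) :=
      isClosed_biUnion_finset fun t _ => isClosed_hull c t
    have htend : Filter.Tendsto (fun r : ℝ => AffineMap.lineMap p (c m) r) (nhdsWithin 0 (Set.Ioi 0))
        (nhds p) := by
      have hc : Continuous (fun r : ℝ => AffineMap.lineMap p (c m) r) := AffineMap.lineMap_continuous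
      have := hc.tendsto 0
      rw [AffineMap.lineMap_apply_zero] at this
      exact this.mono_left nhdsWithin_le_nhds
    have hev : ∀ᶠ r : ℝ in nhdsWithin 0 (Set.Ioi 0),
        AffineMap.lineMap p (c m) r ∈ ⋃ t ∈ F, hull c t := by
      filter_upwards [Ioo_mem_nhdsGT (zero_lt_one (α := ℝ))] with r hr
      have hmem : AffineMap.lineMap p (c m) r ∈ hull c J :=
        (convex_convexHull ℝ _).lineMap_mem hp (mem_hull c hm) ⟨hr.1.le, hr.2.le⟩
      obtain ⟨t, ht, hpt⟩ := hF _ hmem (by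
        rw [orient_lineMap, h0, mul_zero, zero_add]
        exact mul_ne_zero hr.1.ne' hm0)
      exact Set.mem_biUnion ht hpt
    have := hcl.mem_of_tendsto htend hev
    simpa using this
  · exact hF p hp h0

theorem mem_segment_lineMap {A B : Plane} {a r b : ℝ} (ha : a ≤ r) (hb : r ≤ b) :
    AffineMap.lineMap A B r ∈
      segment ℝ (AffineMap.lineMap A B a : Plane) (AffineMap.lineMap A B b) := by
  rw [← image_segment]
  exact ⟨r, by rw [segment_eq_Icc (ha.trans hb)]; exact ⟨ha, hb⟩, rfl⟩

/-- The inner product of `B - A` and `P - A`, a coordinate along the line `A B`. -/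
def along (A B P : Plane) : ℝ := (B 0 - A 0) * (P 0 - A 0) + (B 1 - A 1) * (P 1 - A 1)

theorem along_lineMap (A B : Plane) (s : ℝ) : along A B (AffineMap.lineMap A B s) =
    s * ((B 0 - A 0) ^ 2 + (B 1 - A 1) ^ 2) := by
  simp only [along, AffineMap.lineMap_apply_module, PiLp.add_apply, PiLp.smul_apply, smul_eq_mul]
  ring

theorem along_combo (A B x y : Plane) {a b : ℝ} (h : a + b = 1) :
    along A B (a • x + b • y) = a * along A B x + b * along A B y := by
  obtain rfl : a = 1 - b := by linarith
  simp only [along, PiLp.add_apply, PiLp.smul_apply, smul_eq_mul]; ring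

theorem le_along_of_mem_convexHull {A B p : Plane} {r : ℝ} {S : Set Plane}
    (hS : ∀ x ∈ S, r ≤ along A B x) (hp : p ∈ convexHull ℝ S) : r ≤ along A B p := by
  refine convexHull_min (t := {x | r ≤ along A B x}) hS ?_ hp
  intro x hx y hy a b ha hb h
  simp only [Set.mem_ofPred_eq] at *
  rw [along_combo _ _ _ _ h]
  have e : a * r + b * r = r := by rw [← add_mul, h, one_mul]
  linarith [mul_le_mul_of_nonneg_left hx ha, mul_le_mul_of_nonneg_left hy hb]

theorem along_le_of_mem_convexHull {A B p : Plane} {r : ℝ} {S : Set Plane}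
    (hS : ∀ x ∈ S, along A B x ≤ r) (hp : p ∈ convexHull ℝ S) : along A B p ≤ r := by
  refine convexHull_min (t := {x | along A B x ≤ r}) hS ?_ hp
  intro x hx y hy a b ha hb h
  simp only [Set.mem_ofPred_eq] at *
  rw [along_combo _ _ _ _ h]
  have e : a * r + b * r = r := by rw [← add_mul, h, one_mul]
  linarith [mul_le_mul_of_nonneg_left hx ha, mul_le_mul_of_nonneg_left hy hb]

open Classical in
/-- If the triangles inside an arc that is not flat cover its hull, then one of them is a triangle
on the chord: it is the one that contains the midpoint of the chord. -/
theorem IsIndexTri.exists_chord_triangle (h : IsConvexSeq c n) {T : Finset (Finset ℕ)}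
    (hT : IsIndexTri c n T) {i j : ℕ} (hij : i < j) (hj : j < n) {m : ℕ}
    (hm : m ∈ Finset.Icc i j) (hm0 : orient (c i) (c j) (c m) ≠ 0)
    (hcov : ∀ p ∈ hull c (Finset.Icc i j), ∃ t ∈ T, t ⊆ Finset.Icc i j ∧ p ∈ hull c t) :
    ∃ k, i < k ∧ k < j ∧ {i, k, j} ∈ T := by
  have hi : i < n := hij.trans hj
  have hne : c i ≠ c j := fun e => by have := h.inj i j hi hj e; omega
  have hd := sq_dist_pos hne
  have hiI : i ∈ Finset.Icc i j := Finset.mem_Icc.2 ⟨le_rfl, hij.le⟩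
  have hjI : j ∈ Finset.Icc i j := Finset.mem_Icc.2 ⟨hij.le, le_rfl⟩
  obtain ⟨t, ht, htsub, hmid⟩ := hcov (AffineMap.lineMap (c i) (c j) (1 / 2 : ℝ))
    ((convex_convexHull ℝ _).lineMap_mem (mem_hull c hiI) (mem_hull c hjI)
      ⟨by norm_num, by norm_num⟩)
  have hmid' := mem_hull_filter (c := c) (A := c i) (B := c j) (Or.inr fun x hx =>
    h.orient_nonpos_of_mem_Icc (Finset.mem_Icc.1 (htsub hx)) hj) hmid
    (by simp [orient_lineMap])
  -- No point of the arc lies strictly inside the chord.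
  have hcoord : ∀ x ∈ t, orient (c i) (c j) (c x) = 0 →
      ∃ s : ℝ, c x = AffineMap.lineMap (c i) (c j) s ∧ (s ≤ 0 ∨ 1 ≤ s) := by
    intro x hx hx0
    obtain ⟨s, hs⟩ := exists_lineMap_of_orient_eq_zero hne hx0
    by_cases hsr : s ≤ 0 ∨ 1 ≤ s
    · exact ⟨s, hs, hsr⟩
    exfalso
    push Not at hsr
    have hxI := Finset.mem_Icc.1 (htsub hx)
    rcases hxI.1.eq_or_lt with rfl | hix
    · have h1 := along_lineMap (c i) (c j) s
      rw [← hs] at h1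
      simp only [along, sub_self, mul_zero, add_zero] at h1
      have := mul_pos hsr.1 hd
      linarith
    rcases hxI.2.eq_or_lt with rfl | hxj
    · have h1 := along_lineMap (c i) (c x) s
      rw [← hs] at h1
      simp only [along] at h1
      have := mul_pos (sub_pos.2 hsr.2) hd
      nlinarith
    exact hm0 (h.orient_eq_zero_of_between hix hxj hj hsr.1 hsr.2 hs (Finset.mem_Icc.1 hm))
  -- So the triangle has vertices at or beyond both ends of the chord, and contains the chord.
  have hmval := along_lineMap (c i) (c j) (1 / 2)
  obtain ⟨x, hxt, sx, hsx, hsx0⟩ : ∃ x ∈ t, ∃ s : ℝ,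
      c x = AffineMap.lineMap (c i) (c j) s ∧ s ≤ 0 := by
    by_contra hcon
    push Not at hcon
    have := le_along_of_mem_convexHull (A := c i) (B := c j)
      (r := (c j 0 - c i 0) ^ 2 + (c j 1 - c i 1) ^ 2) (by
      rintro _ ⟨x, hx, rfl⟩
      have hx := Finset.mem_filter.1 hx
      obtain ⟨s, hs, hs'⟩ := hcoord x hx.1 hx.2
      have := hcon x hx.1 s hs
      simp only [hs, along_lineMap]
      nlinarith [hs'.resolve_left (not_le.2 this)]) hmid'
    linarith
  obtain ⟨y, hyt, sy, hsy, hsy1⟩ : ∃ x ∈ t, ∃ s : ℝ,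
      c x = AffineMap.lineMap (c i) (c j) s ∧ 1 ≤ s := by
    by_contra hcon
    push Not at hcon
    have := along_le_of_mem_convexHull (A := c i) (B := c j) (r := 0) (by
      rintro _ ⟨x, hx, rfl⟩
      have hx := Finset.mem_filter.1 hx
      obtain ⟨s, hs, hs'⟩ := hcoord x hx.1 hx.2
      have := hcon x hx.1 s hs
      simp only [hs, along_lineMap]
      nlinarith [hs'.resolve_right (not_le.2 this)]) hmid'
    linarith
  have hseg : ∀ r : ℝ, 0 ≤ r → r ≤ 1 → AffineMap.lineMap (c i) (c j) r ∈ hull c t := by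
    intro r hr0 hr1
    refine segment_subset_hull c hxt hyt ?_
    rw [hsx, hsy]
    exact mem_segment_lineMap (hsx0.trans hr0) (hr1.trans hsy1)
  have hit : i ∈ t := hT.mem_of_mem_hull hi ht (by simpa using hseg 0 le_rfl zero_le_one)
  have hjt : j ∈ t := hT.mem_of_mem_hull hj ht (by simpa using hseg 1 zero_le_one le_rfl)
  obtain ⟨k, hk⟩ := Finset.card_eq_one.1 (show ((t.erase i).erase j).card = 1 by
    rw [Finset.card_erase_of_mem (Finset.mem_erase.2 ⟨hij.ne', hjt⟩), Finset.card_erase_of_mem hit,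
      hT.card_eq t ht])
  have hkt : k ∈ (t.erase i).erase j := by rw [hk]; simp
  simp only [Finset.mem_erase] at hkt
  have hkI := Finset.mem_Icc.1 (htsub hkt.2.2)
  refine ⟨k, by omega, by omega, ?_⟩
  have : t = {i, k, j} := by
    rw [← Finset.insert_erase hit, ← Finset.insert_erase (Finset.mem_erase.2 ⟨hij.ne', hjt⟩), hk,
      Finset.pair_comm]
  rwa [← this]

theorem IsIndexTri.isArcTri_filter (h : IsConvexSeq c n) {T : Finset (Finset ℕ)}
    (hT : IsIndexTri c n T) {i j : ℕ} (hij : i < j) (hj : j < n)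
    (hcov : ∀ p ∈ hull c (Finset.Icc i j), orient (c i) (c j) p ≠ 0 →
      ∃ t ∈ T, t ⊆ Finset.Icc i j ∧ p ∈ hull c t)
    (hmem : ∀ m, i < m → m < j → ∃ t ∈ T, t ⊆ Finset.Icc i j ∧ m ∈ t) :
    IsArcTri (NonCollinear c) i j (T.filter (· ⊆ Finset.Icc i j)) := by
  induction hd : j - i using Nat.strong_induction_on generalizing i j with
  | _ d ih =>
    obtain rfl | hij' : i + 1 = j ∨ i + 1 < j := by omega
    · rw [Finset.filter_false_of_mem]
      · exact .edge i
      · intro t ht hsub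
        have := Finset.card_le_card hsub
        rw [hT.card_eq t ht, Nat.card_Icc] at this
        omega
    have hne : c i ≠ c j := fun e => by have := h.inj i j (by omega) hj e; omega
    -- A triangle inside the arc provides a point off the chord.
    obtain ⟨m, hm, hm0⟩ : ∃ m ∈ Finset.Icc i j, orient (c i) (c j) (c m) ≠ 0 := by
      obtain ⟨t, ht, hsub, -⟩ := hmem (i + 1) (by omega) hij'
      by_contra hcon
      push Not at hcon
      obtain ⟨x, y, z, hxy, hyz, rfl⟩ := exists_eq_triple_of_card (hT.card_eq t ht)
      exact hT.ndeg _ ht x (by simp) y (by simp) z (by simp) hxy.ne hyz.ne (hxy.trans hyz).ne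
        (orient_eq_zero_of_three hne (hcon x (hsub (by simp))) (hcon y (hsub (by simp)))
          (hcon z (hsub (by simp))))
    have hcov' : ∀ p ∈ hull c (Finset.Icc i j), ∃ t ∈ T, t ⊆ Finset.Icc i j ∧ p ∈ hull c t := by
      intro p hp
      obtain ⟨t, ht, hpt⟩ := exists_mem_hull_of_forall_ne (F := T.filter (· ⊆ Finset.Icc i j)) hm hm0
        (fun q hq hq0 => by
          obtain ⟨t, ht, hsub, hqt⟩ := hcov q hq hq0
          exact ⟨t, Finset.mem_filter.2 ⟨ht, hsub⟩, hqt⟩) hp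
      rw [Finset.mem_filter] at ht
      exact ⟨t, ht.1, ht.2, hpt⟩
    obtain ⟨k, hik, hkj, ht⟩ := hT.exists_chord_triangle h hij hj hm hm0 hcov'
    have hk : k < n := hkj.trans hj
    have hN : orient (c i) (c k) (c j) ≠ 0 :=
      hT.ndeg _ ht i (by simp) k (by simp) j (by simp) hik.ne hkj.ne (hik.trans hkj).ne
    have hpos := lt_of_le_of_ne (h.nonneg i k j hik hkj hj) hN.symm
    have hsep := fun s (hs : s ∈ T) hsub => hT.subset_or_subset h hik hkj hj ht (s := s) hs hsub
    have htri : ∀ p ∈ hull c {i, k, j}, 0 ≤ orient (c i) (c k) p ∧ 0 ≤ orient (c k) (c j) p := by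
      have hpos' : 0 ≤ orient (c k) (c j) (c i) := by rw [orient_rotate]; exact hpos.le
      intro p hp
      constructor <;> refine orient_nonneg_of_mem_hull (fun x hx => ?_) hp <;>
        simp only [Finset.mem_insert, Finset.mem_singleton] at hx <;>
        rcases hx with rfl | rfl | rfl <;> simp [hpos.le, hpos']
    have h₁ := ih (k - i) (by omega) hik hk (fun p hp hp0 => by
      have hle : orient (c i) (c k) p ≤ 0 := orient_nonpos_of_mem_hull (fun x hx =>
        h.orient_nonpos_of_mem_Icc (Finset.mem_Icc.1 hx) hk) hp
      obtain ⟨s, hs, hsub, hps⟩ :=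
        hcov' p (hull_mono c (Finset.Icc_subset_Icc_right hkj.le) hp)
      rcases hsep s hs hsub with rfl | hsub' | hsub'
      · exact absurd (le_antisymm hle (htri p hps).1) hp0
      · exact ⟨s, hs, hsub', hps⟩
      · exact absurd (le_antisymm hle (orient_nonneg_of_mem_hull (fun x hx =>
          have hx := Finset.mem_Icc.1 (hsub' hx)
          h.orient_nonneg hik.le hx.1 (hx.2.trans_lt hj)) hps)) hp0)
      (fun m him hmk => by
        obtain ⟨s, hs, hsub, hms⟩ := hmem m him (hmk.trans hkj)
        rcases hsep s hs hsub with rfl | hsub' | hsub'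
        · simp only [Finset.mem_insert, Finset.mem_singleton] at hms; omega
        · exact ⟨s, hs, hsub', hms⟩
        · have := Finset.mem_Icc.1 (hsub' hms); omega) rfl
    have h₂ := ih (j - k) (by omega) hkj hj (fun p hp hp0 => by
      have hle : orient (c k) (c j) p ≤ 0 := orient_nonpos_of_mem_hull (fun x hx =>
        h.orient_nonpos_of_mem_Icc (Finset.mem_Icc.1 hx) hj) hp
      obtain ⟨s, hs, hsub, hps⟩ :=
        hcov' p (hull_mono c (Finset.Icc_subset_Icc_left hik.le) hp)
      rcases hsep s hs hsub with rfl | hsub' | hsub'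
      · exact absurd (le_antisymm hle (htri p hps).2) hp0
      · exact absurd (le_antisymm hle (orient_nonneg_of_mem_hull (fun x hx =>
          h.orient_nonneg_of_le hkj.le (Finset.mem_Icc.1 (hsub' hx)).2 hj) hps)) hp0
      · exact ⟨s, hs, hsub', hps⟩)
      (fun m hkm hmj => by
        obtain ⟨s, hs, hsub, hms⟩ := hmem m (hik.trans hkm) hmj
        rcases hsep s hs hsub with rfl | hsub' | hsub'
        · simp only [Finset.mem_insert, Finset.mem_singleton] at hms; omega
        · have := Finset.mem_Icc.1 (hsub' hms); omega
        · exact ⟨s, hs, hsub', hms⟩) rfl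
    have heq : T.filter (· ⊆ Finset.Icc i j) = insert {i, k, j}
        (T.filter (· ⊆ Finset.Icc i k) ∪ T.filter (· ⊆ Finset.Icc k j)) := by
      ext s
      simp only [Finset.mem_filter, Finset.mem_insert, Finset.mem_union]
      constructor
      · rintro ⟨hs, hsub⟩
        rcases hsep s hs hsub with h' | h' | h'
        · exact Or.inl h'
        · exact Or.inr (Or.inl ⟨hs, h'⟩)
        · exact Or.inr (Or.inr ⟨hs, h'⟩)
      · rintro (rfl | ⟨hs, h'⟩ | ⟨hs, h'⟩)
        · refine ⟨ht, fun x hx => ?_⟩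
          simp only [Finset.mem_insert, Finset.mem_singleton] at hx
          rw [Finset.mem_Icc]; omega
        · exact ⟨hs, h'.trans (Finset.Icc_subset_Icc_right hkj.le)⟩
        · exact ⟨hs, h'.trans (Finset.Icc_subset_Icc_left hik.le)⟩
    rw [heq]
    exact .node hik hkj hN h₁ h₂

theorem isIndexTri_iff_isArcTri (h : IsConvexSeq c n) (hn : 3 ≤ n) {T : Finset (Finset ℕ)} :
    IsIndexTri c n T ↔ IsArcTri (NonCollinear c) 0 (n - 1) T := by
  refine ⟨fun hT => ?_, fun hT => hT.isIndexTri h hn⟩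
  have hr : Finset.Icc 0 (n - 1) = Finset.range n := by ext x; simp; omega
  have := hT.isArcTri_filter h (i := 0) (j := n - 1) (by omega) (by omega)
    (fun p hp _ => by
      rw [hr] at hp ⊢
      obtain ⟨t, ht, hpt⟩ := hT.cover p hp
      exact ⟨t, ht, hT.subset t ht, hpt⟩)
    (fun m _ hm => by
      rw [hr]
      obtain ⟨t, ht, hmt⟩ := hT.mem m (by omega)
      exact ⟨t, ht, hT.subset t ht, hmt⟩)
  rwa [hr, Finset.filter_true_of_mem hT.subset] at this

/-! ### From index sets to points -/

open Classical in
/-- The triangulation of points given by a set of index triples. -/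
def realize (c : ℕ → Plane) (T : Finset (Finset ℕ)) : Finset (Finset Plane) :=
  T.image fun t => t.image c

open Classical in
theorem image_injOn (h : IsConvexSeq c n) {s t : Finset ℕ} (hs : s ⊆ Finset.range n)
    (ht : t ⊆ Finset.range n) (he : s.image c = t.image c) : s = t := by
  have aux : ∀ {s t : Finset ℕ}, s ⊆ Finset.range n → t ⊆ Finset.range n →
      s.image c = t.image c → s ⊆ t := by
    intro s t hs ht he x hx
    have : c x ∈ t.image c := by rw [← he]; exact Finset.mem_image_of_mem c hx
    obtain ⟨y, hy, hxy⟩ := Finset.mem_image.1 this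
    rwa [← h.inj y x (Finset.mem_range.1 (ht hy)) (Finset.mem_range.1 (hs hx)) hxy]
  exact (aux hs ht he).antisymm (aux ht hs he.symm)

theorem realize_injOn (h : IsConvexSeq c n) {S T : Finset (Finset ℕ)}
    (hS : ∀ t ∈ S, t ⊆ Finset.range n) (hT : ∀ t ∈ T, t ⊆ Finset.range n)
    (he : realize c S = realize c T) : S = T := by
  classical
  have aux : ∀ {S T : Finset (Finset ℕ)}, (∀ t ∈ S, t ⊆ Finset.range n) →
      (∀ t ∈ T, t ⊆ Finset.range n) → realize c S = realize c T → S ⊆ T := by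
    intro S T hS hT he s hs
    have : s.image c ∈ realize c T := by rw [← he]; exact Finset.mem_image_of_mem _ hs
    obtain ⟨t, ht, hst⟩ := Finset.mem_image.1 this
    rwa [← image_injOn h (hT t ht) (hS s hs) hst]
  exact (aux hS hT he).antisymm (aux hT hS he.symm)

open Classical in
theorem exists_realize_eq {C : Finset Plane} (hC : C = (Finset.range n).image c)
    {T : Finset (Finset Plane)} (hT : ∀ t ∈ T, t ⊆ C) :
    ∃ S : Finset (Finset ℕ), (∀ s ∈ S, s ⊆ Finset.range n) ∧ realize c S = T := by
  refine ⟨T.image fun t => (Finset.range n).filter (fun x => c x ∈ t), ?_, ?_⟩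
  · intro s hs
    obtain ⟨t, -, rfl⟩ := Finset.mem_image.1 hs
    exact Finset.filter_subset _ _
  · rw [realize, Finset.image_image]
    conv_rhs => rw [← Finset.image_id (s := T)]
    refine Finset.image_congr fun t ht => ?_
    ext p
    simp only [Function.comp_apply, Finset.mem_image, Finset.mem_filter, id]
    constructor
    · rintro ⟨x, ⟨-, hx⟩, rfl⟩; exact hx
    · intro hp
      have := hT t ht hp
      rw [hC] at this
      obtain ⟨x, hx, rfl⟩ := Finset.mem_image.1 this
      exact ⟨x, ⟨hx, hp⟩, rfl⟩

open Classical in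
theorem ndeg_iff_affineIndependent (h : IsConvexSeq c n) {t : Finset ℕ} (ht : t ⊆ Finset.range n)
    (h3 : t.card = 3) :
    Ndeg c t ↔ AffineIndependent ℝ (fun p : {p // p ∈ t.image c} => (p : Plane)) := by
  obtain ⟨x, y, z, hxy, hyz, rfl⟩ := exists_eq_triple_of_card h3
  have hz : z < n := Finset.mem_range.1 (ht (by simp))
  have hinj : Function.Injective ![c x, c y, c z] := by
    have hxy' : c x ≠ c y := fun e => by have := h.inj x y (by omega) (by omega) e; omega
    have hyz' : c y ≠ c z := fun e => by have := h.inj y z (by omega) (by omega) e; omega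
    have hxz' : c x ≠ c z := fun e => by have := h.inj x z (by omega) (by omega) e; omega
    intro a b hab
    fin_cases a <;> fin_cases b <;> simp_all [eq_comm]
  have hrange : Set.range ![c x, c y, c z] =
      ((({x, y, z} : Finset ℕ).image c : Finset Plane) : Set Plane) := by
    ext p
    simp; tauto
  have hiff : AffineIndependent ℝ (fun p => p : Set.range ![c x, c y, c z] → Plane) ↔
      AffineIndependent ℝ ![c x, c y, c z] :=
    ⟨fun ha => ha.of_set_of_injective hinj, fun ha => ha.range⟩
  rw [hrange] at hiff
  refine Iff.trans ?_ hiff.symm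
  constructor
  · intro hnd
    exact affineIndependent_triple
      (hnd x (by simp) y (by simp) z (by simp) hxy.ne hyz.ne (hxy.trans hyz).ne)
  · intro hi
    exact ndeg_triple fun h0 => not_affineIndependent_triple h0 hi

open Classical in
theorem isMaximalTriangulation_realize_iff (h : IsConvexSeq c n) {C : Finset Plane}
    (hC : C = (Finset.range n).image c) {S : Finset (Finset ℕ)}
    (hS : ∀ s ∈ S, s ⊆ Finset.range n) :
    IsMaximalTriangulation C (realize c S) ↔ IsIndexTri c n S := by
  have hmem : ∀ T, T ∈ realize c S ↔ ∃ s ∈ S, s.image c = T := fun T => by simp [realize]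
  have hhull : ∀ s : Finset ℕ, convexHull ℝ ((s.image c : Finset Plane) : Set Plane) = hull c s := by
    intro s; rw [Finset.coe_image]; rfl
  have hCh : convexHull ℝ (C : Set Plane) = hull c (Finset.range n) := by rw [hC, hhull]
  have hcard : ∀ s ∈ S, (s.image c).card = s.card := fun s hs =>
    Finset.card_image_of_injOn fun x hx y hy hxy => h.inj x y
      (Finset.mem_range.1 (hS s hs hx)) (Finset.mem_range.1 (hS s hs hy)) hxy
  have hvert : ∀ s ∈ S, ∀ x < n, c x ∈ s.image c ↔ x ∈ s := by
    intro s hs x hx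
    rw [Finset.mem_image]
    constructor
    · rintro ⟨y, hy, hxy⟩
      rwa [← h.inj y x (Finset.mem_range.1 (hS s hs hy)) hx hxy]
    · exact fun hx => ⟨x, hx, rfl⟩
  have hint : ∀ s ∈ S, ∀ t ∈ S, convexHull ℝ (((s.image c : Finset Plane) : Set Plane) ∩
      ((t.image c : Finset Plane) : Set Plane)) = hull c (s ∩ t) := by
    intro s hs t ht
    rw [hull, ← Finset.coe_inter, ← Finset.coe_image]
    congr 2
    ext p
    simp only [Finset.mem_inter, Finset.mem_image]
    constructor
    · rintro ⟨⟨x, hx, rfl⟩, y, hy, hxy⟩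
      obtain rfl := h.inj y x (Finset.mem_range.1 (hS t ht hy)) (Finset.mem_range.1 (hS s hs hx)) hxy
      exact ⟨y, ⟨hx, hy⟩, rfl⟩
    · rintro ⟨x, ⟨hx, hy⟩, rfl⟩
      exact ⟨⟨x, hx, rfl⟩, x, hy, rfl⟩
  constructor
  · rintro ⟨hT, hmax⟩
    have h3 : ∀ s ∈ S, s.card = 3 := fun s hs => by
      rw [← hcard s hs]; exact hT.card_eq _ ((hmem _).2 ⟨s, hs, rfl⟩)
    refine ⟨hS, h3, fun s hs => ?_, fun p hp => ?_, fun s hs t ht hst p hps hpt => ?_,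
      fun x hx => ?_⟩
    · exact (ndeg_iff_affineIndependent h (hS s hs) (h3 s hs)).2
        (hT.indep _ ((hmem _).2 ⟨s, hs, rfl⟩))
    · rw [← hCh, ← hT.cover] at hp
      simp only [Set.mem_iUnion] at hp
      obtain ⟨_, ht, hp⟩ := hp
      obtain ⟨s, hs, rfl⟩ := (hmem _).1 ht
      exact ⟨s, hs, by rwa [hhull] at hp⟩
    · have := hT.inter _ ((hmem _).2 ⟨s, hs, rfl⟩) _ ((hmem _).2 ⟨t, ht, rfl⟩)
        (fun e => hst (image_injOn h (hS s hs) (hS t ht) e))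
      rw [hint s hs t ht, hhull, hhull] at this
      rw [← this]; exact ⟨hps, hpt⟩
    · obtain ⟨_, ht, hx'⟩ := hmax (c x) (by
        rw [hC]; exact Finset.mem_image_of_mem c (Finset.mem_range.2 hx))
      obtain ⟨s, hs, rfl⟩ := (hmem _).1 ht
      exact ⟨s, hs, (hvert s hs x hx).1 hx'⟩
  · intro hT
    refine ⟨⟨fun t ht => ?_, fun t ht => ?_, fun t ht => ?_, ?_, fun s hs t ht hst => ?_⟩,
      fun P hP => ?_⟩
    · obtain ⟨s, hs, rfl⟩ := (hmem _).1 ht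
      rw [hC]; exact Finset.image_subset_image (hS s hs)
    · obtain ⟨s, hs, rfl⟩ := (hmem _).1 ht
      rw [hcard s hs, hT.card_eq s hs]
    · obtain ⟨s, hs, rfl⟩ := (hmem _).1 ht
      exact (ndeg_iff_affineIndependent h (hS s hs) (hT.card_eq s hs)).1 (hT.ndeg s hs)
    · refine Set.Subset.antisymm (Set.iUnion₂_subset fun t ht => ?_) fun p hp => ?_
      · obtain ⟨s, hs, rfl⟩ := (hmem _).1 ht
        rw [hhull, hCh]; exact hull_mono c (hS s hs)
      · rw [hCh] at hp
        obtain ⟨s, hs, hps⟩ := hT.cover p hp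
        rw [← hhull] at hps
        exact Set.mem_biUnion (x := s.image c) ((hmem _).2 ⟨s, hs, rfl⟩) hps
    · obtain ⟨s, hs', rfl⟩ := (hmem _).1 hs
      obtain ⟨t, ht', rfl⟩ := (hmem _).1 ht
      rw [hint s hs' t ht', hhull, hhull]
      refine Set.Subset.antisymm (fun p hp => hT.inter s hs' t ht' (fun e => hst (by rw [e])) p
        hp.1 hp.2) fun p hp => ⟨hull_mono c Finset.inter_subset_left hp,
          hull_mono c Finset.inter_subset_right hp⟩
    · rw [hC] at hP
      obtain ⟨x, hx, rfl⟩ := Finset.mem_image.1 hP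
      obtain ⟨s, hs, hxs⟩ := hT.mem x (Finset.mem_range.1 hx)
      exact ⟨_, (hmem _).2 ⟨s, hs, rfl⟩, Finset.mem_image_of_mem c hxs⟩

open Classical in
theorem tauMax_eq_of_hasCount (h : IsConvexSeq c n) (hn : 3 ≤ n) {C : Finset Plane}
    (hC : C = (Finset.range n).image c) {m : ℤ}
    (hm : HasCount (NonCollinear c) 0 (n - 1) m) : (tauMax C : ℤ) = m := by
  obtain ⟨F, hF, rfl⟩ := hm
  have hF' : ∀ T, T ∈ F ↔ IsIndexTri c n T := fun T => by
    rw [hF, isIndexTri_iff_isArcTri h hn]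
  have hset : {T | IsMaximalTriangulation C T} = ((F.image (realize c) : Finset _) : Set _) := by
    ext T
    rw [Finset.mem_coe, Finset.mem_image]
    constructor
    · intro hT
      obtain ⟨S, hS, rfl⟩ := exists_realize_eq hC (T := T) hT.1.subset
      exact ⟨S, (hF' S).2 ((isMaximalTriangulation_realize_iff h hC hS).1 hT), rfl⟩
    · rintro ⟨S, hS, rfl⟩
      have := (hF' S).1 hS
      exact (isMaximalTriangulation_realize_iff h hC this.subset).2 this
  rw [tauMax, hset, Set.ncard_coe_finset, Finset.card_image_of_injOn]
  intro S hS T hT he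
  exact realize_injOn h ((hF' S).1 hS).subset ((hF' T).1 hT).subset he

end Triangulations

/-! ### Corners of a weakly convex polygon -/

/-- The points `V 0, …, V (l - 1)` are the corners, in counterclockwise order, of a strictly convex
polygon; the sequence `V` is continued periodically. -/
structure IsCornerSeq (V : ℕ → Plane) (l : ℕ) : Prop where
  three_le : 3 ≤ l
  eq_iff : ∀ x y, V x = V y ↔ x % l = y % l
  pos : ∀ r s, V s ≠ V r → V s ≠ V (r + 1) → 0 < orient (V r) (V (r + 1)) (V s)

namespace IsCornerSeq

variable {V : ℕ → Plane} {l : ℕ}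

theorem apply_self (h : IsCornerSeq V l) : V l = V 0 := by
  rw [h.eq_iff]; simp

theorem ne (h : IsCornerSeq V l) {x y : ℕ} (hx : x < l) (hy : y < l) (hxy : x ≠ y) : V x ≠ V y := by
  rwa [Ne, h.eq_iff, Nat.mod_eq_of_lt hx, Nat.mod_eq_of_lt hy]

theorem ne_succ (h : IsCornerSeq V l) (r : ℕ) : V r ≠ V (r + 1) := by
  have h3 := h.three_le
  rw [Ne, h.eq_iff]
  intro e
  have e : r ≡ r + 1 [MOD l] := e
  have := (Nat.modEq_iff_dvd' (by omega)).1 e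
  rw [Nat.add_sub_cancel_left] at this
  have := Nat.le_of_dvd one_pos this
  omega

theorem pos_consecutive (h : IsCornerSeq V l) (r : ℕ) :
    0 < orient (V r) (V (r + 1)) (V (r + 2)) := by
  have h3 := h.three_le
  refine h.pos r (r + 2) (fun e => ?_) (h.ne_succ (r + 1)).symm
  rw [h.eq_iff] at e
  have e : r ≡ r + 2 [MOD l] := Eq.symm e
  have := (Nat.modEq_iff_dvd' (by omega)).1 e
  rw [Nat.add_sub_cancel_left] at this
  have := Nat.le_of_dvd two_pos this
  omega

/-- Local convexity at the corners gives the orientation of all triples, by induction along the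
Grassmann-Plücker relation. -/
theorem pos_of_lt (h : IsCornerSeq V l) {x y z : ℕ} (hxy : x < y) (hyz : y < z) (hz : z < l) :
    0 < orient (V x) (V y) (V z) := by
  have base : ∀ w, x + 1 < w → w < l → 0 < orient (V x) (V (x + 1)) (V w) := fun w h1 h2 =>
    h.pos x w (h.ne h2 (by omega) (by omega)) (h.ne h2 (by omega) (by omega))
  rcases (Nat.succ_le_of_lt hxy).eq_or_lt with rfl | hxy'
  · exact base z hyz hz
  induction z, hyz using Nat.le_induction with
  | base =>
    have := h.pos y x (h.ne (by omega) (by omega) (by omega)) (h.ne (by omega) hz (by omega))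
    rwa [orient_rotate] at this
  | succ z hyz ih =>
    have hyz : y < z := hyz
    have h1 := orient_plucker (V x) (V (x + 1)) (V y) (V z) (V (z + 1))
    have h2 := h.pos z x (h.ne (by omega) (by omega) (by omega)) (h.ne (by omega) hz (by omega))
    rw [orient_rotate] at h2
    have h3 := mul_pos (base y hxy' (by omega)) h2
    have h4 := mul_pos (base (z + 1) (by omega) hz) (ih (by omega))
    exact pos_of_mul_pos_right (by rw [h1]; linarith) (base z (by omega) (by omega)).le

theorem nonneg_of_le (h : IsCornerSeq V l) {x y z : ℕ} (hxy : x ≤ y) (hyz : y ≤ z) (hz : z ≤ l) :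
    0 ≤ orient (V x) (V y) (V z) := by
  have aux : ∀ {x y z : ℕ}, x ≤ y → y ≤ z → z < l → 0 ≤ orient (V x) (V y) (V z) := by
    intro x y z hxy hyz hz
    rcases hxy.eq_or_lt with rfl | hxy
    · simp
    rcases hyz.eq_or_lt with rfl | hyz
    · simp
    exact (h.pos_of_lt hxy hyz hz).le
  rcases hz.eq_or_lt with rfl | hz
  · rcases hyz.eq_or_lt with rfl | hyz
    · simp
    · rw [h.apply_self, orient_rotate]; exact aux (Nat.zero_le x) hxy hyz
  · exact aux hxy hyz hz

/-- A point of the half-open side `r` lies to the left of the later side `s`, or on it if it is the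
corner `0` and `s` is the last side. -/
theorem side_of_lt (h : IsCornerSeq V l) {r s : ℕ} (hrs : r < s) (hs : s < l) {u : ℝ} (hu0 : 0 ≤ u)
    (hu1 : u < 1) :
    0 ≤ orient (V s) (V (s + 1)) (AffineMap.lineMap (V r) (V (r + 1)) u) ∧
    (orient (V s) (V (s + 1)) (AffineMap.lineMap (V r) (V (r + 1)) u) = 0 ↔
      s + 1 = l ∧ r = 0 ∧ u = 0) := by
  have h3 := h.three_le
  rw [orient_lineMap]
  have h2 : 0 ≤ orient (V s) (V (s + 1)) (V (r + 1)) := by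
    rw [orient_rotate]; exact h.nonneg_of_le (by omega) (by omega) (by omega)
  by_cases hc : s + 1 = l ∧ r = 0
  · obtain ⟨hc, rfl⟩ := hc
    have h1 : 0 < orient (V s) (V (s + 1)) (V (0 + 1)) := by
      rw [hc, h.apply_self, orient_rotate]
      rw [orient_rotate]
      exact h.pos_of_lt (by omega) (by omega) hs
    have h0 : orient (V s) (V (s + 1)) (V 0) = 0 := by rw [hc, h.apply_self]; simp
    rw [h0, mul_zero, zero_add]
    refine ⟨by positivity, ?_⟩
    rw [mul_eq_zero, or_iff_left h1.ne']
    simp [hc]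
  · have h1 : 0 < orient (V s) (V (s + 1)) (V r) := by
      refine h.pos s r (h.ne (by omega) hs (by omega)) ?_
      rw [Ne, h.eq_iff, Nat.mod_eq_of_lt (show r < l by omega)]
      intro e
      rcases (Nat.succ_le_of_lt hs).eq_or_lt with h' | h'
      · rw [Nat.succ_eq_add_one] at h'
        rw [h', Nat.mod_self] at e
        exact hc ⟨h', e⟩
      · rw [Nat.mod_eq_of_lt h'] at e; omega
    have h4 := mul_pos (sub_pos.2 hu1) h1
    have h5 := mul_nonneg hu0 h2
    refine ⟨by linarith, ⟨fun e => by linarith, fun e => (hc ⟨e.1, e.2.1⟩).elim⟩⟩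

/-- A point of the half-open side `t` lies to the left of the earlier side `r`, or on it if it is
the common corner. -/
theorem side_of_gt (h : IsCornerSeq V l) {r t : ℕ} (hrt : r < t) (ht : t < l) {u : ℝ} (hu0 : 0 ≤ u)
    (hu1 : u < 1) :
    0 ≤ orient (V r) (V (r + 1)) (AffineMap.lineMap (V t) (V (t + 1)) u) ∧
    (orient (V r) (V (r + 1)) (AffineMap.lineMap (V t) (V (t + 1)) u) = 0 ↔
      t = r + 1 ∧ u = 0) := by
  rw [orient_lineMap]
  by_cases hc : t = r + 1
  · subst hc
    have h1 := h.pos_consecutive r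
    rw [show r + 1 + 1 = r + 2 from rfl, orient_self_right, mul_zero, zero_add]
    refine ⟨by positivity, ?_⟩
    rw [mul_eq_zero]
    simp [h1.ne']
  · have h1 := h.pos_of_lt (Nat.lt_succ_self r) (show r + 1 < t by omega) ht
    have h2 := h.nonneg_of_le (Nat.le_succ r) (show r + 1 ≤ t + 1 by omega) (show t + 1 ≤ l by omega)
    have h4 := mul_pos (sub_pos.2 hu1) h1
    have h5 := mul_nonneg hu0 h2
    simp only [Nat.succ_eq_add_one] at *
    refine ⟨by linarith, ⟨fun e => by linarith, fun e => (hc e.1).elim⟩⟩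

theorem pos_of_lt_of_lt (h : IsCornerSeq V l) {r s t : ℕ} (hrs : r < s) (hst : s < t) (ht : t < l)
    {u v w : ℝ} (hu0 : 0 ≤ u) (hu1 : u < 1) (hv0 : 0 ≤ v) (hv1 : v < 1) (hw0 : 0 ≤ w)
    (hw1 : w < 1) :
    0 < orient (AffineMap.lineMap (V r) (V (r + 1)) u) (AffineMap.lineMap (V s) (V (s + 1)) v)
      (AffineMap.lineMap (V t) (V (t + 1)) w) := by
  have expand : ∀ A A' B B' D D' : Plane, orient (AffineMap.lineMap A A' u)
      (AffineMap.lineMap B B' v) (AffineMap.lineMap D D' w) =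
      (1 - u) * (1 - v) * (1 - w) * orient A B D + (1 - u) * (1 - v) * w * orient A B D' +
      (1 - u) * v * (1 - w) * orient A B' D + (1 - u) * v * w * orient A B' D' +
      u * (1 - v) * (1 - w) * orient A' B D + u * (1 - v) * w * orient A' B D' +
      u * v * (1 - w) * orient A' B' D + u * v * w * orient A' B' D' := by
    intros
    simp only [orient, AffineMap.lineMap_apply_module, PiLp.add_apply, PiLp.smul_apply, smul_eq_mul]
    ring
  have hu := sub_pos.2 hu1
  have hv := sub_pos.2 hv1
  have hw := sub_pos.2 hw1
  have h0 := h.pos_of_lt hrs hst ht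
  have h1 := h.nonneg_of_le (x := r) (y := s) (z := t + 1) (by omega) (by omega) (by omega)
  have h2 := h.nonneg_of_le (x := r) (y := s + 1) (z := t) (by omega) (by omega) (by omega)
  have h3 := h.nonneg_of_le (x := r) (y := s + 1) (z := t + 1) (by omega) (by omega) (by omega)
  have h4 := h.nonneg_of_le (x := r + 1) (y := s) (z := t) (by omega) (by omega) (by omega)
  have h5 := h.nonneg_of_le (x := r + 1) (y := s) (z := t + 1) (by omega) (by omega) (by omega)
  have h6 := h.nonneg_of_le (x := r + 1) (y := s + 1) (z := t) (by omega) (by omega) (by omega)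
  have h7 := h.nonneg_of_le (x := r + 1) (y := s + 1) (z := t + 1) (by omega) (by omega) (by omega)
  rw [expand]
  positivity

end IsCornerSeq

/-! ### The boundary curve -/

/-- The boundary of the polygon with corners `V`, parametrized so that the corner `r` is reached at
time `r`. -/
def boundary (V : ℕ → Plane) (τ : ℝ) : Plane :=
  AffineMap.lineMap (V ⌊τ⌋₊) (V (⌊τ⌋₊ + 1)) (τ - ⌊τ⌋₊)

theorem boundary_nat_add (V : ℕ → Plane) (r : ℕ) {u : ℝ} (hu0 : 0 ≤ u) (hu1 : u < 1) :
    boundary V (r + u) = AffineMap.lineMap (V r) (V (r + 1)) u := by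
  have : ⌊(r : ℝ) + u⌋₊ = r := by
    rw [Nat.floor_eq_iff (by positivity)]
    constructor <;> linarith
  rw [boundary, this, add_sub_cancel_left]

theorem boundary_nat (V : ℕ → Plane) (r : ℕ) : boundary V r = V r := by
  have := boundary_nat_add V r le_rfl zero_lt_one
  simpa using this

theorem exists_nat_add {τ : ℝ} {l : ℕ} (h0 : 0 ≤ τ) (hl : τ < l) :
    ∃ (r : ℕ) (u : ℝ), r < l ∧ 0 ≤ u ∧ u < 1 ∧ τ = r + u :=
  ⟨⌊τ⌋₊, τ - ⌊τ⌋₊, (Nat.floor_lt h0).2 hl, sub_nonneg.2 (Nat.floor_le h0),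
    by linarith [Nat.lt_floor_add_one τ], by ring⟩

namespace IsCornerSeq

variable {V : ℕ → Plane} {l : ℕ}

theorem boundary_ne (h : IsCornerSeq V l) {τ σ : ℝ} (h0 : 0 ≤ τ) (hτσ : τ < σ) (hl : σ < l) :
    boundary V τ ≠ boundary V σ := by
  obtain ⟨r, u, hr, hu0, hu1, rfl⟩ := exists_nat_add h0 (hτσ.trans hl)
  obtain ⟨s, v, hs, hv0, hv1, rfl⟩ := exists_nat_add (h0.trans hτσ.le) hl
  rw [boundary_nat_add V r hu0 hu1, boundary_nat_add V s hv0 hv1]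
  have hrs : r ≤ s := by
    have : (r : ℝ) < s + 1 := by linarith
    exact_mod_cast Nat.lt_succ_iff.1 (by exact_mod_cast this)
  intro e
  rcases hrs.eq_or_lt with rfl | hrs
  · have := AffineMap.lineMap_injective ℝ (h.ne_succ r) e
    linarith
  · have h1 := h.side_of_lt hrs hs hu0 hu1
    have h2 : orient (V s) (V (s + 1)) (AffineMap.lineMap (V r) (V (r + 1)) u) = 0 := by
      rw [e, orient_lineMap]; simp
    obtain ⟨hsl, rfl, rfl⟩ := h1.2.1 h2
    rw [AffineMap.lineMap_apply_zero, ← h.apply_self, ← hsl] at e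
    have h3 : AffineMap.lineMap (V s) (V (s + 1)) (1 : ℝ) = AffineMap.lineMap (V s) (V (s + 1)) v := by
      rw [← e, AffineMap.lineMap_apply_one]
    have := AffineMap.lineMap_injective ℝ (h.ne_succ s) h3
    linarith

/-- Orientation of three points on the boundary: they are collinear only if they lie on a common
side, and the last side ends in the corner `0`. -/
theorem orient_boundary (h : IsCornerSeq V l) {τ₁ τ₂ τ₃ : ℝ} (h0 : 0 ≤ τ₁) (h12 : τ₁ < τ₂)
    (h23 : τ₂ < τ₃) (hl : τ₃ < l) :
    0 ≤ orient (boundary V τ₁) (boundary V τ₂) (boundary V τ₃) ∧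
    (orient (boundary V τ₁) (boundary V τ₂) (boundary V τ₃) = 0 ↔
      τ₃ ≤ ⌊τ₁⌋₊ + 1 ∨ (τ₁ = 0 ∧ (l : ℝ) ≤ τ₂ + 1)) := by
  have h3 := h.three_le
  have h3' : (3 : ℝ) ≤ l := by exact_mod_cast h3
  obtain ⟨r, u, hr, hu0, hu1, rfl⟩ := exists_nat_add h0 (h12.trans (h23.trans hl))
  obtain ⟨s, v, hs, hv0, hv1, rfl⟩ := exists_nat_add (h0.trans h12.le) (h23.trans hl)
  obtain ⟨t, w, ht, hw0, hw1, rfl⟩ := exists_nat_add (h0.trans (h12.le.trans h23.le)) hl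
  have hfl : ⌊(r : ℝ) + u⌋₊ = r := by
    rw [Nat.floor_eq_iff (by positivity)]
    constructor <;> linarith
  rw [boundary_nat_add V r hu0 hu1, boundary_nat_add V s hv0 hv1, boundary_nat_add V t hw0 hw1, hfl]
  have hrs : r ≤ s := Nat.lt_succ_iff.1 (by
    have : (r : ℝ) < s + 1 := by linarith
    exact_mod_cast this)
  have hst : s ≤ t := Nat.lt_succ_iff.1 (by
    have : (s : ℝ) < t + 1 := by linarith
    exact_mod_cast this)
  rcases hrs.eq_or_lt with rfl | hrs <;> rcases hst.eq_or_lt with rfl | hst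
  · have : orient (AffineMap.lineMap (V r) (V (r + 1)) u) (AffineMap.lineMap (V r) (V (r + 1)) v)
        (AffineMap.lineMap (V r) (V (r + 1)) w) = 0 := by
      rw [orient_lineMap_lineMap, orient_lineMap]; simp
    rw [this]
    exact ⟨le_rfl, ⟨fun _ => Or.inl (by linarith), fun _ => rfl⟩⟩
  · rw [orient_lineMap_lineMap]
    have h1 := h.side_of_gt hst ht hw0 hw1
    have h2 : 0 < v - u := by linarith
    refine ⟨mul_nonneg h2.le h1.1, ?_⟩
    rw [mul_eq_zero, or_iff_right h2.ne', h1.2]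
    have hst' : (r : ℝ) + 1 ≤ t := by exact_mod_cast hst
    constructor
    · rintro ⟨rfl, rfl⟩; left; push_cast; linarith
    · rintro (h4 | ⟨h4, h5⟩)
      · have : (t : ℝ) ≤ (r + 1 : ℕ) := by push_cast; linarith
        have : t ≤ r + 1 := by exact_mod_cast this
        obtain rfl : t = r + 1 := by omega
        refine ⟨rfl, ?_⟩
        push_cast at h4; linarith
      · have hr0 : (0 : ℝ) ≤ r := by positivity
        linarith
  · rw [← orient_rotate, orient_lineMap_lineMap]
    have h1 := h.side_of_lt hrs hs hu0 hu1
    have h2 : 0 < w - v := by linarith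
    refine ⟨mul_nonneg h2.le h1.1, ?_⟩
    rw [mul_eq_zero, or_iff_right h2.ne', h1.2]
    have hrs' : (r : ℝ) + 1 ≤ s := by exact_mod_cast hrs
    constructor
    · rintro ⟨h4, rfl, rfl⟩
      right
      rw [← h4]; push_cast
      constructor <;> linarith
    · rintro (h4 | ⟨h4, h5⟩)
      · linarith
      · have hr0 : (0 : ℝ) ≤ r := by positivity
        have hr0' : (r : ℝ) = 0 := by linarith
        have hls : (l : ℝ) < (s + 2 : ℕ) := by push_cast; linarith
        have : l < s + 2 := by exact_mod_cast hls
        exact ⟨by omega, by exact_mod_cast hr0', by linarith⟩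
  · have h1 := h.pos_of_lt_of_lt hrs hst ht hu0 hu1 hv0 hv1 hw0 hw1
    refine ⟨h1.le, ⟨fun e => absurd e h1.ne', ?_⟩⟩
    have hrs' : (r : ℝ) + 1 ≤ s := by exact_mod_cast hrs
    have hst' : (s : ℝ) + 1 ≤ t := by exact_mod_cast hst
    have htl : (t : ℝ) + 1 ≤ l := by exact_mod_cast ht
    rintro (h4 | ⟨h4, h5⟩)
    · linarith
    · linarith

theorem exists_boundary_eq (h : IsCornerSeq V l) {r : ℕ} (hr : r < l) {P : Plane}
    (hP : P ∈ segment ℝ (V r) (V (r + 1))) : ∃ τ : ℝ, 0 ≤ τ ∧ τ < l ∧ boundary V τ = P := by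
  rw [segment_eq_image_lineMap] at hP
  obtain ⟨u, ⟨hu0, hu1⟩, rfl⟩ := hP
  have hrl : (r : ℝ) + 1 ≤ l := by exact_mod_cast hr
  rcases hu1.eq_or_lt with rfl | hu1
  · rw [AffineMap.lineMap_apply_one]
    rcases (Nat.succ_le_of_lt hr).eq_or_lt with h' | h'
    · refine ⟨(0 : ℕ), by simp, by exact_mod_cast (show 0 < l by omega), ?_⟩
      rw [boundary_nat, ← h.apply_self, ← h']
    · exact ⟨((r + 1 : ℕ) : ℝ), by positivity, by exact_mod_cast h', boundary_nat _ _⟩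
  · exact ⟨r + u, by positivity, by linarith, boundary_nat_add V r hu0 hu1⟩

end IsCornerSeq

/-! ### The corners of a polygon of given weights -/

theorem not_mem_segment_of_mem_extr {C : Finset Plane} {P A B : Plane} (hP : P ∈ extr C)
    (hA : A ∈ C) (hB : B ∈ C) (hAP : A ≠ P) (hBP : B ≠ P) : P ∉ segment ℝ A B := by
  intro hseg
  refine hP.2 (Set.Subset.antisymm (convexHull_mono Set.sdiff_subset) ?_)
  refine convexHull_min (fun Q hQ => ?_) (convex_convexHull ℝ _)
  by_cases hQP : Q = P
  · rw [hQP]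
    exact (convex_convexHull ℝ _).segment_subset
      (subset_convexHull ℝ _ (show A ∈ (C : Set Plane) \ {P} from ⟨hA, hAP⟩))
      (subset_convexHull ℝ _ (show B ∈ (C : Set Plane) \ {P} from ⟨hB, hBP⟩)) hseg
  · exact subset_convexHull ℝ _ ⟨hQ, hQP⟩

theorem orient_ne_zero_of_mem_extr {C : Finset Plane} {A B D : Plane} (hA : A ∈ extr C)
    (hB : B ∈ extr C) (hD : D ∈ extr C) (hAB : A ≠ B) (hDA : D ≠ A) (hDB : D ≠ B) :
    orient A B D ≠ 0 := by
  intro h0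
  obtain ⟨s, hs⟩ := exists_lineMap_of_orient_eq_zero hAB h0
  have e0 : A = AffineMap.lineMap A B (0 : ℝ) := by simp
  have e1 : B = AffineMap.lineMap A B (1 : ℝ) := by simp
  rcases le_total s 0 with h | h
  · have := mem_segment_lineMap (A := A) (B := B) h zero_le_one
    rw [← hs, ← e0, ← e1] at this
    exact not_mem_segment_of_mem_extr hA hD.1 hB.1 hDA hAB.symm this
  rcases le_total s 1 with h' | h'
  · have := mem_segment_lineMap (A := A) (B := B) h h'
    rw [← hs, ← e0, ← e1] at this
    exact not_mem_segment_of_mem_extr hD hA.1 hB.1 hDA.symm hDB.symm this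
  · have := mem_segment_lineMap (A := A) (B := B) zero_le_one h'
    rw [← hs, ← e0, ← e1] at this
    exact not_mem_segment_of_mem_extr hB hA.1 hD.1 hAB hDB this

theorem continuous_orient (A B : Plane) : Continuous fun P => orient A B P := by
  unfold orient; fun_prop

/-- A point strictly to the left of all sides lies in the hull of the corners: it lies in one of
the triangles of the fan with apex `V 0`. -/
theorem IsCornerSeq.mem_convexHull {V : ℕ → Plane} {l : ℕ} (h : IsCornerSeq V l) {Q : Plane}
    (hQ : ∀ r < l, 0 < orient (V r) (V (r + 1)) Q) : Q ∈ convexHull ℝ (Set.range V) := by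
  classical
  have h3 := h.three_le
  have hlast : orient (V 0) (V (l - 1)) Q < 0 := by
    have := hQ (l - 1) (by omega)
    rw [show l - 1 + 1 = l by omega, h.apply_self, orient_swap] at this
    linarith
  have hex : ∃ r, orient (V 0) (V (r + 1)) Q < 0 := ⟨l - 2, by rwa [show l - 2 + 1 = l - 1 by omega]⟩
  have hr := Nat.find_spec hex
  have hmin : ∀ m < Nat.find hex, ¬ orient (V 0) (V (m + 1)) Q < 0 := fun m hm => Nat.find_min hex hm
  have hle : Nat.find hex ≤ l - 2 := Nat.find_min' hex (by rwa [show l - 2 + 1 = l - 1 by omega])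
  generalize Nat.find hex = r at hr hmin hle
  rcases r with _ | r
  · have := hQ 0 (by omega)
    linarith
  have h1 := not_lt.1 (hmin r (Nat.lt_succ_self r))
  have h2 := hQ (r + 1) (by omega)
  refine convexHull_mono ?_ (mem_convexHull_triangle
    (h.pos_of_lt (x := 0) (y := r + 1) (z := r + 2) (by omega) (by omega) (by omega)) h1 h2.le
    (by rw [orient_swap]; linarith))
  rintro _ (rfl | rfl | rfl) <;> exact Set.mem_range_self _

/-- The corners of a polygon of given weights, continued periodically. -/
theorem exists_isCornerSeq {l : ℕ} (hl : 3 ≤ l) {a : Fin l → ℕ} {C : Finset Plane}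
    (hC : IsPolygonOfWeights a C) : ∃ V : ℕ → Plane, IsCornerSeq V l ∧ (∀ r, V r ∈ C) ∧
      (∀ r, ∀ P ∈ C, 0 ≤ orient (V r) (V (r + 1)) P) ∧
      ∀ r : Fin l, Set.ncard {P : Plane | P ∈ C ∧ P ∈ segment ℝ (V r) (V (r + 1))} = a r + 1 := by
  obtain ⟨-, v, hinj, hrange, hv⟩ := hC
  obtain ⟨k, rfl⟩ : ∃ k, l = k + 1 := ⟨l - 1, by omega⟩
  set V : ℕ → Plane := fun r => v ⟨r % (k + 1), Nat.mod_lt _ k.succ_pos⟩ with hV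
  have hV' : ∀ r : Fin (k + 1), V r = v r := fun r => by
    simp only [hV]; congr 1; ext; exact Nat.mod_eq_of_lt r.2
  have hsucc : ∀ r : ℕ, V (r + 1) = v (finRotate (k + 1) ⟨r % (k + 1), Nat.mod_lt _ k.succ_pos⟩) := by
    intro r
    simp only [hV]
    congr 1
    rw [finRotate_apply]
    ext
    simp [Fin.val_add]
  have hext : ∀ r, V r ∈ extr C := fun r => by rw [← hrange]; exact Set.mem_range_self _
  have hleft : ∀ r, ∀ P ∈ C, 0 ≤ orient (V r) (V (r + 1)) P := fun r => by
    rw [hsucc]; exact (hv _).1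
  have heq : ∀ x y, V x = V y ↔ x % (k + 1) = y % (k + 1) := fun x y => by
    simp only [hV, hinj.eq_iff, Fin.mk.injEq]
  refine ⟨V, ⟨hl, heq, fun r s h1 h2 => ?_⟩, fun r => (hext r).1, hleft, fun r => ?_⟩
  · refine lt_of_le_of_ne (hleft r _ (hext s).1) (Ne.symm ?_)
    refine orient_ne_zero_of_mem_extr (hext r) (hext (r + 1)) (hext s) (fun e => ?_) h1 h2
    rw [heq] at e
    have e : r ≡ r + 1 [MOD k + 1] := e
    have := (Nat.modEq_iff_dvd' (by omega)).1 e
    rw [Nat.add_sub_cancel_left] at this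
    have := Nat.le_of_dvd one_pos this
    omega
  · have := (hv r).2
    have he : (⟨r % (k + 1), Nat.mod_lt _ k.succ_pos⟩ : Fin (k + 1)) = r :=
      Fin.ext (Nat.mod_eq_of_lt r.2)
    rw [hV', hsucc, he]
    exact this

/-- Every point of a weakly convex configuration lies on a side: a point strictly to the left of all
sides is an inner point of the convex hull. -/
theorem exists_mem_side {l : ℕ} {C : Finset Plane} (hC : IsWeaklyConvex C) {V : ℕ → Plane}
    (h : IsCornerSeq V l) (hVC : ∀ r, V r ∈ C)
    (hleft : ∀ r, ∀ P ∈ C, 0 ≤ orient (V r) (V (r + 1)) P) {P : Plane} (hP : P ∈ C) :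
    ∃ r < l, P ∈ segment ℝ (V r) (V (r + 1)) := by
  have h3 := h.three_le
  obtain ⟨r, hr, hr0⟩ : ∃ r < l, orient (V r) (V (r + 1)) P = 0 := by
    by_contra hcon
    push Not at hcon
    have hopen : IsOpen (⋂ r ∈ Finset.range l, {Q | 0 < orient (V r) (V (r + 1)) Q}) :=
      isOpen_biInter_finset fun r _ => isOpen_lt continuous_const (continuous_orient _ _)
    refine (hC hP).2 (mem_interior.2 ⟨_, fun Q hQ => ?_, hopen, ?_⟩)
    · simp only [Set.mem_iInter, Finset.mem_range, Set.mem_ofPred_eq] at hQ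
      refine convexHull_mono ?_ (h.mem_convexHull hQ)
      rintro _ ⟨r, rfl⟩
      exact hVC r
    · simp only [Set.mem_iInter, Finset.mem_range, Set.mem_ofPred_eq]
      exact fun r hr => lt_of_le_of_ne (hleft r P hP) (hcon r hr).symm
  refine ⟨r, hr, ?_⟩
  obtain ⟨u, rfl⟩ := exists_lineMap_of_orient_eq_zero (h.ne_succ r) hr0
  have h1 := hleft (r + 1) _ hP
  rw [orient_lineMap, orient_self_left, mul_zero, add_zero, orient_rotate] at h1
  have hu1 : 0 ≤ 1 - u := nonneg_of_mul_nonneg_left h1 (h.pos_consecutive r)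
  -- The side before side `r` is taken one period later, to stay within the natural numbers.
  have hper : ∀ m, V (m + l) = V m := fun m => by rw [h.eq_iff]; simp
  have h2 := hleft (r + l - 1) _ hP
  have h4 := h.pos_consecutive (r + l - 1)
  rw [show r + l - 1 + 2 = r + 1 + l by omega, show r + l - 1 + 1 = r + l by omega, hper, hper] at h4
  rw [show r + l - 1 + 1 = r + l by omega, hper, orient_lineMap, orient_self_right, mul_zero,
    zero_add] at h2
  have hu0 : 0 ≤ u := nonneg_of_mul_nonneg_left h2 h4
  rw [segment_eq_image_lineMap]
  exact ⟨u, ⟨hu0, by linarith⟩, rfl⟩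

theorem eq_range_card_of_forall_lt {D : Finset ℕ} (hD : ∀ x ∈ D, ∀ y < x, y ∈ D) :
    D = Finset.range D.card := by
  refine Finset.eq_of_subset_of_card_le (fun x hx => ?_) (by simp)
  have : Finset.range (x + 1) ⊆ D := fun y hy => by
    rcases (Nat.lt_succ_iff.1 (Finset.mem_range.1 hy)).eq_or_lt with rfl | hy
    · exact hx
    · exact hD x hx y hy
  have := Finset.card_le_card this
  rw [Finset.card_range] at this
  exact Finset.mem_range.2 this

/-- A finite set of reals, listed in increasing order. -/
theorem exists_strictMono_enumeration (S : Finset ℝ) : ∃ τ : ℕ → ℝ,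
    (∀ x y, x < y → y < S.card → τ x < τ y) ∧ (∀ x < S.card, τ x ∈ S) ∧
    ∀ s ∈ S, ∃ x < S.card, τ x = s := by
  refine ⟨fun m => if hm : m < S.card then S.orderEmbOfFin rfl ⟨m, hm⟩ else 0, ?_, ?_, ?_⟩
  · intro x y hxy hy
    simp only [hy, hxy.trans hy, dif_pos]
    exact (S.orderEmbOfFin rfl).strictMono hxy
  · intro x hx
    simp only [hx, dif_pos]
    exact Finset.orderEmbOfFin_mem _ _ _
  · intro s hs
    have : s ∈ Set.range (S.orderEmbOfFin rfl) := by rw [Finset.range_orderEmbOfFin]; exact hs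
    obtain ⟨⟨x, hx⟩, hxs⟩ := this
    exact ⟨x, hx, by simp only [hx, dif_pos]; exact hxs⟩

open Classical in
/-- The points of a polygon of given weights, listed counterclockwise from a corner; `κ r` is the
index of the corner `r`. -/
theorem exists_enumeration {l : ℕ} (hl : 3 ≤ l) {a : Fin l → ℕ} {C : Finset Plane}
    (hC : IsPolygonOfWeights a C) : ∃ (c : ℕ → Plane) (n : ℕ) (κ : ℕ → ℕ),
      IsConvexSeq c n ∧ C = (Finset.range n).image c ∧ κ 0 = 0 ∧
      (∀ r : Fin l, κ (r + 1) = κ r + a r) ∧ κ l = n ∧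
      ∀ i k j, i < k → k < j → j < n → (NonCollinear c i k j ↔
        (∃ r < l, i < κ r ∧ κ r < j) ∧ ¬ (i = 0 ∧ κ (l - 1) ≤ k)) := by
  obtain ⟨V, h, hVC, hleft, hcard⟩ := exists_isCornerSeq hl hC
  have hinj : ∀ τ σ : ℝ, 0 ≤ τ → τ < l → 0 ≤ σ → σ < l → boundary V τ = boundary V σ → τ = σ := by
    intro τ σ h1 h2 h3 h4 e
    rcases lt_trichotomy τ σ with h' | h' | h'
    · exact absurd e (h.boundary_ne h1 h' h4)
    · exact h'
    · exact absurd e.symm (h.boundary_ne h3 h' h2)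
  have hfin : {τ : ℝ | (0 ≤ τ ∧ τ < l) ∧ boundary V τ ∈ C}.Finite := by
    refine Set.Finite.of_finite_image (f := boundary V) (C.finite_toSet.subset ?_) ?_
    · rintro _ ⟨τ, hτ, rfl⟩; exact hτ.2
    · intro τ hτ σ hσ e
      exact hinj τ σ hτ.1.1 hτ.1.2 hσ.1.1 hσ.1.2 e
  -- `S` consists of the times at which the boundary curve meets `C`, and `τ` lists them. The index
  -- `κ r` of the corner `r` is the number of earlier points.
  set S := hfin.toFinset with hS
  have hmemS : ∀ τ, τ ∈ S ↔ (0 ≤ τ ∧ τ < l) ∧ boundary V τ ∈ C := fun τ => by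
    rw [hS, Set.Finite.mem_toFinset]; rfl
  obtain ⟨τ, hmono, hτS, hτsurj⟩ := exists_strictMono_enumeration S
  set n := S.card with hn
  set κ : ℕ → ℕ := fun r => (S.filter (· < (r : ℝ))).card with hκ
  have hlt_iff : ∀ m < n, ∀ r : ℕ, τ m < r ↔ m < κ r := by
    intro m hm r
    have hD : (Finset.range n).filter (fun m => τ m < r) = Finset.range (κ r) := by
      have h1 := eq_range_card_of_forall_lt (D := (Finset.range n).filter (fun m => τ m < r)) (by
        intro x hx y hyx
        rw [Finset.mem_filter, Finset.mem_range] at hx ⊢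
        exact ⟨hyx.trans hx.1, (hmono y x hyx hx.1).trans hx.2⟩)
      rw [h1]
      congr 1
      have h2 : S.filter (· < (r : ℝ)) = ((Finset.range n).filter (fun m => τ m < r)).image τ := by
        ext s
        simp only [Finset.mem_filter, Finset.mem_image, Finset.mem_range]
        constructor
        · rintro ⟨hs, hsr⟩
          obtain ⟨x, hx, rfl⟩ := hτsurj s hs
          exact ⟨x, ⟨hx, hsr⟩, rfl⟩
        · rintro ⟨x, ⟨hx, hxr⟩, rfl⟩
          exact ⟨hτS x hx, hxr⟩
      rw [hκ]
      simp only
      rw [h2, Finset.card_image_of_injOn]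
      intro x hx y hy e
      simp only [Finset.coe_filter, Finset.mem_range, Set.mem_ofPred_eq] at hx hy
      rcases lt_trichotomy x y with h' | h' | h'
      · exact absurd e (hmono x y h' hy.1).ne
      · exact h'
      · exact absurd e.symm (hmono y x h' hx.1).ne
    have := congrArg (m ∈ ·) hD
    simp only [Finset.mem_filter, Finset.mem_range, hm, true_and, eq_iff_iff] at this
    exact this
  have hcorner : ∀ r < l, κ r < n ∧ τ (κ r) = r := by
    intro r hr
    obtain ⟨m, hm, hmr⟩ := hτsurj r ((hmemS _).2 ⟨⟨by positivity, by exact_mod_cast hr⟩, by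
      rw [boundary_nat]; exact hVC r⟩)
    have h1 : ¬ m < κ r := by rw [← hlt_iff m hm, hmr]; exact lt_irrefl _
    have h2 : ¬ κ r < m := fun h' => by
      have h3 := hmono _ _ h' hm
      rw [hmr, hlt_iff _ (h'.trans hm)] at h3
      exact lt_irrefl _ h3
    obtain rfl : m = κ r := by omega
    exact ⟨hm, hmr⟩
  have hκ0 : κ 0 = 0 := by
    simp only [hκ]
    rw [Finset.card_eq_zero, Finset.filter_false_of_mem]
    intro s hs
    rw [hmemS] at hs
    simpa using hs.1.1
  have hτ0 : τ 0 = 0 := by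
    have := (hcorner 0 (by omega)).2
    rwa [hκ0, Nat.cast_zero] at this
  have hτrange : ∀ m < n, 0 ≤ τ m ∧ τ m < l := fun m hm => ((hmemS _).1 (hτS m hm)).1
  have hκl : κ l = n := by
    simp only [hκ]
    rw [Finset.filter_true_of_mem]
    intro s hs
    exact ((hmemS s).1 hs).1.2
  have hstep : ∀ r : Fin l, κ (r + 1) = κ r + a r := by
    intro r
    have hr1 : ((r : ℕ) : ℝ) + 1 ≤ l := by exact_mod_cast r.2
    have hsplit : S.filter (· < ((r + 1 : ℕ) : ℝ)) = S.filter (· < ((r : ℕ) : ℝ)) ∪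
        S.filter (fun s => ((r : ℕ) : ℝ) ≤ s ∧ s < (r : ℕ) + 1) := by
      ext s
      simp only [Finset.mem_filter, Finset.mem_union]
      push_cast
      constructor
      · rintro ⟨hs, h1⟩
        rcases lt_or_ge s (r : ℕ) with h2 | h2
        · exact Or.inl ⟨hs, h2⟩
        · exact Or.inr ⟨hs, h2, h1⟩
      · rintro (⟨hs, h1⟩ | ⟨hs, -, h1⟩)
        · exact ⟨hs, by linarith⟩
        · exact ⟨hs, h1⟩
    have himage : boundary V '' (S.filter (fun s => ((r : ℕ) : ℝ) ≤ s ∧ s < (r : ℕ) + 1) : Finset ℝ) =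
        {P : Plane | P ∈ C ∧ P ∈ segment ℝ (V r) (V (r + 1))} \ {V (r + 1)} := by
      ext P
      constructor
      · rintro ⟨s, hs, rfl⟩
        rw [Finset.mem_coe, Finset.mem_filter, hmemS] at hs
        obtain ⟨u, rfl⟩ : ∃ u : ℝ, s = (r : ℕ) + u := ⟨s - (r : ℕ), by ring⟩
        have hu0 : 0 ≤ u := by linarith [hs.2.1]
        have hu1 : u < 1 := by linarith [hs.2.2]
        have hb := boundary_nat_add V r hu0 hu1
        refine ⟨⟨hs.1.2, ?_⟩, ?_⟩
        · rw [hb, segment_eq_image_lineMap]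
          exact ⟨u, ⟨hu0, hu1.le⟩, rfl⟩
        · rw [hb, Set.mem_singleton_iff]
          intro e
          have : AffineMap.lineMap (V r) (V (r + 1)) u =
              AffineMap.lineMap (V r) (V (r + 1)) (1 : ℝ) := by
            rw [e, AffineMap.lineMap_apply_one]
          have := AffineMap.lineMap_injective ℝ (h.ne_succ r) this
          linarith
      · rintro ⟨⟨hPC, hseg⟩, hne⟩
        rw [segment_eq_image_lineMap] at hseg
        obtain ⟨u, ⟨hu0, hu1⟩, rfl⟩ := hseg
        have hu1 : u < 1 := lt_of_le_of_ne hu1 (by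
          rintro rfl; exact hne (by simp))
        have hb := boundary_nat_add V r hu0 hu1
        refine ⟨(r : ℕ) + u, ?_, hb⟩
        rw [Finset.mem_coe, Finset.mem_filter, hmemS, hb]
        exact ⟨⟨⟨by positivity, by linarith⟩, hPC⟩, by linarith, by linarith⟩
    have hc := congrArg Set.ncard himage
    rw [Set.InjOn.ncard_image, Set.ncard_coe_finset, Set.ncard_sdiff_singleton_of_mem, hcard r,
      Nat.add_sub_cancel] at hc
    · simp only [hκ]
      rw [hsplit, Finset.card_union_of_disjoint, hc]
      rw [Finset.disjoint_left]
      intro s hs hs'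
      rw [Finset.mem_filter] at hs hs'
      exact absurd hs.2 (not_lt.2 hs'.2.1)
    · exact ⟨hVC _, right_mem_segment _ _ _⟩
    · intro x hx y hy e
      rw [Finset.mem_coe, Finset.mem_filter, hmemS] at hx hy
      exact hinj x y hx.1.1.1 hx.1.1.2 hy.1.1.1 hy.1.1.2 e
  refine ⟨fun m => boundary V (τ m), n, κ, ⟨?_, ?_⟩, ?_, hκ0, hstep, hκl, ?_⟩
  · intro x y hx hy e
    have := hinj _ _ (hτrange x hx).1 (hτrange x hx).2 (hτrange y hy).1 (hτrange y hy).2 e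
    rcases lt_trichotomy x y with h' | h' | h'
    · exact absurd this (hmono x y h' hy).ne
    · exact h'
    · exact absurd this.symm (hmono y x h' hx).ne
  · intro x y z hxy hyz hz
    exact (h.orient_boundary (hτrange x (by omega)).1 (hmono x y hxy (by omega)) (hmono y z hyz hz)
      (hτrange z hz).2).1
  · ext P
    simp only [Finset.mem_image, Finset.mem_range]
    constructor
    · intro hP
      obtain ⟨r, hr, hseg⟩ := exists_mem_side hC.1 h hVC hleft hP
      obtain ⟨t, ht0, htl, rfl⟩ := h.exists_boundary_eq hr hseg
      obtain ⟨x, hx, rfl⟩ := hτsurj t ((hmemS t).2 ⟨⟨ht0, htl⟩, hP⟩)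
      exact ⟨x, hx, rfl⟩
    · rintro ⟨x, hx, rfl⟩
      exact ((hmemS _).1 (hτS x hx)).2
  · intro i k j hik hkj hj
    have hi : i < n := by omega
    have hk : k < n := by omega
    have key := (h.orient_boundary (hτrange i hi).1 (hmono i k hik hk) (hmono k j hkj hj)
      (hτrange j hj).2).2
    rw [NonCollinear, Ne, key, not_or]
    refine and_congr ?_ (not_congr (and_congr ?_ ?_))
    · rw [not_le]
      constructor
      · intro hlt
        have hr : ⌊τ i⌋₊ + 1 < l := by
          have := hlt.trans (hτrange j hj).2
          exact_mod_cast this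
        refine ⟨⌊τ i⌋₊ + 1, hr, ?_, ?_⟩
        · rw [← hlt_iff i hi]; push_cast; exact Nat.lt_floor_add_one _
        · have hc := hcorner _ hr
          by_contra hcon
          rcases (not_lt.1 hcon).eq_or_lt with e | h'
          · rw [e, hc.2] at hlt; push_cast at hlt; exact lt_irrefl _ hlt
          · have := hmono _ _ h' hc.1
            rw [hc.2] at this; push_cast at this; linarith
      · rintro ⟨r, hr, hir, hrj⟩
        rw [← hlt_iff i hi] at hir
        have h1 : ⌊τ i⌋₊ + 1 ≤ r := (Nat.floor_lt (hτrange i hi).1).2 hir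
        have h2 := hmono _ _ hrj hj
        rw [(hcorner r hr).2] at h2
        have h3 : ((⌊τ i⌋₊ + 1 : ℕ) : ℝ) ≤ r := by exact_mod_cast h1
        push_cast at h3; linarith
    · constructor
      · intro e
        by_contra hne
        have := hmono 0 i (by omega) hi
        rw [hτ0, e] at this
        exact lt_irrefl _ this
      · rintro rfl; exact hτ0
    · have := hlt_iff k hk (l - 1)
      rw [Nat.cast_sub (by omega), Nat.cast_one] at this
      rw [← not_lt, ← not_lt, ← this]
      exact not_congr ⟨fun h' => by linarith, fun h' => by linarith⟩

open Classical in
/-- The number of maximal triangulations in terms of the edge polynomials. -/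
theorem tauMax_eq_polygonFun {l : ℕ} (hl : 3 ≤ l) {a : Fin l → ℕ} (ha : ∀ i, 1 ≤ a i)
    {C : Finset Plane} (hC : IsPolygonOfWeights a C) :
    (tauMax C : ℤ) = polygonFun (∏ i, edgePoly (a i)) := by
  obtain ⟨c, n, κ, hc, hCc, hκ0, hκ, hκl, hN⟩ := exists_enumeration hl hC
  have hstep : ∀ r < l, κ r < κ (r + 1) := fun r hr => by
    have := hκ ⟨r, hr⟩
    have := ha ⟨r, hr⟩
    simp only at *
    omega
  have hmono : ∀ r s, r < s → s ≤ l → κ r < κ s := by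
    intro r s hrs hs
    induction s, hrs using Nat.le_induction with
    | base => exact hstep r (by omega)
    | succ s hrs ih => exact (ih (by omega)).trans (hstep s (by omega))
  set ε : ℕ → ℤ := fun m => if ∃ r < l, m = κ r then 0 else 1 with hε
  have hε01 : ∀ m, ε m = 0 ∨ ε m = 1 := fun m => by simp only [hε]; split_ifs <;> simp
  have hε0 : ∀ m, ε m = 0 ↔ ∃ r < l, m = κ r := fun m => by simp [hε]
  have hflat : ∀ r < l, ∀ m, κ r < m → m < κ (r + 1) → ε m = 1 := by
    intro r hr m h1 h2
    refine (hε01 m).resolve_left fun h0 => ?_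
    obtain ⟨s, hs, rfl⟩ := (hε0 m).1 h0
    rcases lt_trichotomy r s with h' | rfl | h'
    · rcases (Nat.succ_le_of_lt h').eq_or_lt with rfl | h''
      · exact lt_irrefl _ h2
      · have := hmono _ _ h'' hs.le
        simp only [Nat.succ_eq_add_one] at this
        omega
    · exact lt_irrefl _ h1
    · have := hmono _ _ h' hr.le
      omega
  have hprod : ∀ r ≤ l, arcPoly ε 0 (κ r) =
      ∏ i ∈ (Finset.univ : Finset (Fin l)).filter (fun i : Fin l => (i : ℕ) < r), edgePoly (a i) := by
    intro r hr
    induction r with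
    | zero => rw [hκ0]; simp [arcPoly]
    | succ r ih =>
      have hins : (Finset.univ : Finset (Fin l)).filter (fun i : Fin l => (i : ℕ) < r + 1) =
          insert ⟨r, hr⟩ ((Finset.univ : Finset (Fin l)).filter (fun i : Fin l => (i : ℕ) < r)) := by
        ext i
        simp only [Finset.mem_filter, Finset.mem_univ, true_and, Finset.mem_insert, Fin.ext_iff]
        omega
      have hk := hκ ⟨r, hr⟩
      simp only at hk
      rw [hins, Finset.prod_insert (by simp), ← ih (by omega), hk, arcPoly_add, mul_comm]
      · exact fun _ => (hε0 _).2 ⟨r, hr, rfl⟩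
      · intro m h1 h2
        exact hflat r hr m h1 (by rwa [hk])
  have hA : κ (l - 1) < n := by rw [← hκl]; exact hmono _ _ (by omega) le_rfl
  have h1A : κ 1 < κ (l - 1) := hmono _ _ (by omega) (by omega)
  have h01 : 0 < κ 1 := by have := hmono 0 1 one_pos (by omega); omega
  have hn : 3 ≤ n := by omega
  -- Unless it has a vertex `0` and two vertices on the last side, a triangle is degenerate only if
  -- no corner lies strictly between its extreme indices.
  have hsub : ∀ x y z, 0 < x ∨ z ≤ κ (l - 1) → x < y → y < z → z < n →
      (NonCollinear c x y z ↔ ∃ m, x < m ∧ m < z ∧ ε m = 0) := by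
    intro x y z hxz hxy hyz hz
    rw [hN x y z hxy hyz hz, and_iff_left (by omega)]
    constructor
    · rintro ⟨r, hr, h1, h2⟩
      exact ⟨κ r, h1, h2, (hε0 _).2 ⟨r, hr, rfl⟩⟩
    · rintro ⟨m, h1, h2, h0⟩
      obtain ⟨r, hr, rfl⟩ := (hε0 m).1 h0
      exact ⟨r, hr, h1, h2⟩
  have hroot : ∀ k, 0 < k → k < n - 1 → (NonCollinear c 0 k (n - 1) ↔ k < κ (l - 1)) := by
    intro k hk0 hk
    rw [hN 0 k (n - 1) hk0 hk (by omega), and_iff_right ⟨1, by omega, h01, by omega⟩]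
    omega
  have hcount := HasCount.node (N := NonCollinear c) (i := 0) (j := n - 1) (by omega)
    (g₁ := fun k => arcCount ε 0 k) (g₂ := fun k => arcCount ε k (n - 1))
    (fun k hk hk' => by
      rw [Finset.mem_Ioo] at hk
      rw [hroot k hk.1 hk.2] at hk'
      exact hasCount_arcCount hε01 hk.1 fun x y z _ h2 h3 h4 =>
        hsub x y z (Or.inr (by omega)) h2 h3 (by omega))
    (fun k hk hk' => by
      rw [Finset.mem_Ioo] at hk
      exact hasCount_arcCount hε01 hk.2 fun x y z h1 h2 h3 h4 =>
        hsub x y z (Or.inl (by omega)) h2 h3 (by omega))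
  have hfilter : ∀ inst : DecidablePred fun k => NonCollinear c 0 k (n - 1),
      @Finset.filter _ (fun k => NonCollinear c 0 k (n - 1)) inst (Finset.Ioo 0 (n - 1)) =
      Finset.Ioo 0 (κ (l - 1)) := by
    intro inst
    ext k
    rw [Finset.mem_filter, Finset.mem_Ioo, Finset.mem_Ioo]
    constructor
    · rintro ⟨⟨h1, h2⟩, h3⟩
      exact ⟨h1, (hroot k h1 h2).1 h3⟩
    · rintro ⟨h1, h2⟩
      exact ⟨⟨h1, by omega⟩, (hroot k h1 (by omega)).2 h2⟩
  rw [hfilter, sum_arcCount_root ε hA h01 h1A ((hε0 _).2 ⟨1, by omega, rfl⟩)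
    ((hε0 _).2 ⟨l - 1, by omega, rfl⟩) (fun m h1 h2 => hflat (l - 1) (by omega) m h1 (by
      rw [show l - 1 + 1 = l by omega, hκl]; exact h2)), ← hκl, hprod l le_rfl,
    Finset.filter_true_of_mem (fun i _ => i.2), hκl] at hcount
  exact tauMax_eq_of_hasCount hc hn hCc hcount

end WeaklyConvex

end

theorem mainTheorem2 (l : ℕ) (hl : 3 ≤ l) (a : Fin l → ℕ) (ha : ∀ i, 1 ≤ a i)
    (C : Finset WeaklyConvex.Plane) (hC : WeaklyConvex.IsPolygonOfWeights a C) :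
    (WeaklyConvex.tauMax C : ℤ) =
        WeaklyConvex.pairing (∏ i, WeaklyConvex.edgePoly (a i))
          (PowerSeries.X ^ 2 * WeaklyConvex.genCatalan) ∧
      (WeaklyConvex.tauMax C : ℤ) =
        ∑ k ∈ Finset.Icc 2 (∏ i, WeaklyConvex.edgePoly (a i)).natDegree,
          (∏ i, WeaklyConvex.edgePoly (a i)).coeff k * (catalan (k - 2) : ℤ) := by
  rw [WeaklyConvex.pairing_eq_polygonFun, ← WeaklyConvex.polygonFun_eq_sum_Icc,
    WeaklyConvex.tauMax_eq_polygonFun hl ha hC]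
  exact ⟨rfl, rfl⟩
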